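/- **Setting.** For each $B=1,2,\dots$ consider a study with $B$ matched sets, the $i$-th of size $n_i\ge 2$ (all quantities may depend on $B$), $N=\sum_{i=1}^B n_i$. Individual $j$ of set $i$ has fixed potential outcomes $r_{Tij},r_{Cij}$ and treatment indicator $Z_{ij}$; before matching the $Z_{ij}$ are independent with $\pi_{ij}=P(Z_{ij}=1)\in(0,1)$. All probabilities, expectations and variances below are conditional on the event $\mathcal Z$ that each set has exactly one treated individual (potential outcomes and hidden biases being fixed). Rosenbaum's model holds at $\Gamma\ge 1$ if $1/\Gamma\le \pi_{ij}(1-\pi_{ij'})/\{\pi_{ij'}(1-\pi_{ij})\}\le\Gamma$ for all $i,j,j'$. For $u=(u_{ij})\in[0,1]^N$ let $P_u,E_u$ refer to the conditional assignment law $P_u(Z=z\mid\mathcal Z)\propto\Gamma^{\sum_{i,j} z_{ij}u_{ij}}$; under Rosenbaum's model at $\Gamma$ the true law is of this form. Let $\tau_{ij}=r_{Tij}-r_{Cij}$, $\bar\tau_i=n_i^{-1}\sum_j\tau_{ij}$, $\bar\tau=N^{-1}\sum_{i,j}\tau_{ij}$, $\delta_{ij}=r_{Tij}-\sum_{j'\ne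 j}r_{Cij'}/(n_i-1)$, and let $\hat\tau_i=\sum_jZ_{ij}\delta_{ij}$ be the treated-minus-control difference in means in set $i$. For fixed $\tau_0$ put $$D_{\Gamma i}=\hat\tau_i-\tau_0-\frac{\Gamma-1}{1+\Gamma}|\hat\tau_i-\tau_0|,\qquad \bar D_\Gamma=\sum_{i=1}^B\frac{n_i}{N}D_{\Gamma i}.$$ Let $p$ be fixed and for each $B>p$ let $Q$ be a nonrandom $B\times p$ matrix with $Q^TQ$ invertible, whose hat matrix $H_Q=Q(Q^TQ)^{-1}Q^T$ has diagonal entries $h_{Qii}<1$. Let $Y_i=B(n_i/N)D_{\Gamma i}/\sqrt{1-h_{Qii}}$ and $\mathrm{se}_Q^2=Y^T(I-H_Q)Y/B^2$. The test is $\varphi(\alpha,\Gamma)=1\{\bar D_\Gamma/\mathrm{se}_Q\ge\Phi^{-1}(1-\alpha)\}$, where $0<\alpha\le 0.5$. The weak null is $\bar\tau=\tau_0$ (for every $B$); the sharp null is $\tau_{ij}=\tau_0$ for all $i,j$ (and every $B$). *Regularity conditions:* $\liminf_B B\,\mathrm{var}(\bar D_\Gamma)>0$ and, for some $\eta>0$,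 $$\sum_{i=1}^B(n_i/N)^{2+\eta}E|D_{\Gamma i}-E D_{\Gamma i}|^{2+\eta}\big/\mathrm{var}(\bar D_\Gamma)^{1+\eta/2}\to 0 .$$ *Covariance conditions* (cov is the sample covariance over $i=1,\dots,B$): (a) $\liminf_{B\to\infty}\sqrt B\,\mathrm{cov}\{P(\hat\tau_i\ge\bar\tau_i\mid\mathcal Z),\,n_i(\bar\tau_i-\tau_0)\}\ge0$ for the true assignment law; (b) for some $u^*$ maximizing $E_u(\bar D_\Gamma\mid\mathcal Z)$ over $u\in[0,1]^N$, $\liminf_{B\to\infty}\sqrt B\,\mathrm{cov}\{P_{u^*}(\hat\tau_i\ge\bar\tau_i\mid\mathcal Z),\,n_i(\bar\tau_i-\tau_0)\}\ge0$. **Theorem.** Let $\Gamma\ge1$, $0<\alpha\le0.5$, $\tau_0\in\mathbb R$, and let any set sizes $n_i\ge 2$ and any $Q$ as above be given. 1. If Rosenbaum's model holds at $\Gamma$, the weak null is true, the regularity conditions hold, and (a) or (b) holds, then $\limsup_{B\to\infty}E\{\varphi(\alpha,\Gamma)\mid\mathcal Z\}\le\alpha$. Equality is possible: there are potential outcomes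 satisfying the weak null but, for every $B$, not the sharp null, and assignment probabilities satisfying Rosenbaum's model at $\Gamma$, such that the regularity conditions, (a) and (b) hold and $\lim_{B\to\infty}E\{\varphi(\alpha,\Gamma)\mid\mathcal Z\}=\alpha$. 2. If Rosenbaum's model holds at $\Gamma$ and the sharp null is true, then (a) and (b) both hold, and under the regularity conditions $\limsup_{B\to\infty}E\{\varphi(\alpha,\Gamma)\mid\mathcal Z\}\le\alpha$. If moreover the true conditional assignment law is $P_u$ with $u_{ij}=1(\delta_{ij}\ge\tau_0)$, then under the regularity conditions $\lim_{B\to\infty}E\{\varphi(\alpha,\Gamma)\mid\mathcal Z\}=\alpha$; and in the given (arbitrary) matched design there are potential outcomes satisfying the sharp null and assignment probabilities satisfying Rosenbaum's model at $\Gamma$ for which this occurs. -/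

import Mathlib

open Filter Topology

noncomputable section

namespace MatchedStudy

/-! ## One matched study: `B` matched sets, the `i`-th containing `n i` individuals -/

/-- The potential outcomes under treatment and under control of all individuals. -/
structure Outcomes {B : ℕ} (n : Fin B → ℕ) where
  /-- potential outcome under treatment -/
  rT : ∀ i, Fin (n i) → ℝ
  /-- potential outcome under control -/
  rC : ∀ i, Fin (n i) → ℝ

/-- A vector of treatment indicators; `z i j = true` when individual `j` of set `i` is treated. -/
abbrev Treatment {B : ℕ} (n : Fin B → ℕ) : Type := ∀ i : Fin B, Fin (n i) → Bool

/-- The numerical value `0` or `1` of a treatment indicator. -/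
def ind (b : Bool) : ℝ := if b = true then 1 else 0

section OneStudy

variable {B : ℕ} {n : Fin B → ℕ}

/-- The set `Ω` of treatment vectors with exactly one treated individual in each matched set. -/
def Omega (n : Fin B → ℕ) : Finset (Treatment n) :=
  Finset.univ.filter fun z => ∀ i, (Finset.univ.filter fun j => z i j = true).card = 1

/-- The total number of individuals `N`. -/
def total (n : Fin B → ℕ) : ℝ := ∑ i, (n i : ℝ)

namespace Outcomes

variable (r : Outcomes n)

/-- Individual treatment effect. -/
def effect (i : Fin B) (j : Fin (n i)) : ℝ := r.rT i j - r.rC i j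

/-- Average treatment effect in matched set `i`. -/
def setEffect (i : Fin B) : ℝ := (∑ j, r.effect i j) / (n i : ℝ)

/-- Sample average treatment effect. -/
def avgEffect : ℝ := (∑ i, ∑ j, r.effect i j) / total n

/-- The value that the treated-minus-control difference in means of set `i` takes when individual
`j` is the treated one. -/
def diffIf (i : Fin B) (j : Fin (n i)) : ℝ :=
  r.rT i j - (∑ k ∈ Finset.univ.erase j, r.rC i k) / ((n i : ℝ) - 1)

/-- The weak null: the sample average treatment effect equals `τ₀`. -/
def WeakNull (τ₀ : ℝ) : Prop := r.avgEffect = τ₀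

/-- The sharp null: the treatment effect is constant at `τ₀`. -/
def SharpNull (τ₀ : ℝ) : Prop := ∀ i j, r.rT i j = r.rC i j + τ₀

/-- Observed response. -/
def observed (z : Treatment n) (i : Fin B) (j : Fin (n i)) : ℝ :=
  r.rT i j * ind (z i j) + r.rC i j * (1 - ind (z i j))

/-- Observed treated-minus-control difference in means in set `i`. -/
def tauHat (z : Treatment n) (i : Fin B) : ℝ :=
  ∑ j, (ind (z i j) * r.observed z i j
    - (1 - ind (z i j)) * r.observed z i j / ((n i : ℝ) - 1))

/-- The statistic of set `i`. -/
def D (Γ τ₀ : ℝ) (z : Treatment n) (i : Fin B) : ℝ :=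
  r.tauHat z i - τ₀ - ((Γ - 1) / (1 + Γ)) * |r.tauHat z i - τ₀|

/-- The overall test statistic, the average of the `D` weighted by the set sizes. -/
def Dbar (Γ τ₀ : ℝ) (z : Treatment n) : ℝ := ∑ i, ((n i : ℝ) / total n) * r.D Γ τ₀ z i

end Outcomes

/-- The hat matrix of `Q`. -/
def hat {p : ℕ} (Q : Matrix (Fin B) (Fin p) ℝ) : Matrix (Fin B) (Fin B) ℝ :=
  Q * (Q.transpose * Q)⁻¹ * Q.transpose

namespace Outcomes

variable (r : Outcomes n)

/-- The weighted and leverage-adjusted set statistics. -/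
def Y {p : ℕ} (Q : Matrix (Fin B) (Fin p) ℝ) (Γ τ₀ : ℝ) (z : Treatment n) (i : Fin B) : ℝ :=
  (B : ℝ) * ((n i : ℝ) / total n) * r.D Γ τ₀ z i / √(1 - hat Q i i)

/-- The standard error of `Dbar` built from `Q`. -/
def se {p : ℕ} (Q : Matrix (Fin B) (Fin p) ℝ) (Γ τ₀ : ℝ) (z : Treatment n) : ℝ :=
  √((r.Y Q Γ τ₀ z ⬝ᵥ Matrix.mulVec (1 - hat Q) (r.Y Q Γ τ₀ z)) / (B : ℝ) ^ 2)

end Outcomes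

/-- The quantile function of the standard normal distribution. -/
def normalQuantile (q : ℝ) : ℝ :=
  sInf {x : ℝ | q ≤ ProbabilityTheory.cdf (ProbabilityTheory.gaussianReal 0 1) x}

/-- The candidate level `α` sensitivity analysis: `1` when it rejects, `0` otherwise. -/
def Outcomes.test (r : Outcomes n) {p : ℕ} (Q : Matrix (Fin B) (Fin p) ℝ) (Γ τ₀ α : ℝ)
    (z : Treatment n) : ℝ :=
  if normalQuantile (1 - α) ≤ r.Dbar Γ τ₀ z / r.se Q Γ τ₀ z then 1 else 0

/-! ### Treatment assignment -/

/-- Before matching, individuals are treated independently, with probabilities `prob i j`: the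
probability of the treatment vector `z`. -/
def assignWeight (prob : ∀ i, Fin (n i) → ℝ) (z : Treatment n) : ℝ :=
  ∏ i, ∏ j, if z i j = true then prob i j else 1 - prob i j

/-- Rosenbaum's model at `Γ`: two individuals in the same matched set differ in their odds of
treatment by a factor of at most `Γ`. -/
def SensModel (Γ : ℝ) (prob : ∀ i, Fin (n i) → ℝ) : Prop :=
  (∀ i j, 0 < prob i j ∧ prob i j < 1) ∧
  ∀ i j k, 1 / Γ ≤ (prob i j * (1 - prob i k)) / (prob i k * (1 - prob i j)) ∧
    (prob i j * (1 - prob i k)) / (prob i k * (1 - prob i j)) ≤ Γ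

/-- Exponential weights `exp (γ zᵀu)`, `γ = log Γ`, of the hidden-bias form of the model. -/
def biasWeight (Γ : ℝ) (u : ∀ i, Fin (n i) → ℝ) (z : Treatment n) : ℝ :=
  Real.exp (Real.log Γ * ∑ i, ∑ j, ind (z i j) * u i j)

/-- Probability of `z` given `Ω`, for the weights `w`. -/
def condProb (w : Treatment n → ℝ) (z : Treatment n) : ℝ := w z / ∑ b ∈ Omega n, w b

/-- Expectation of `f` given `Ω`, for the weights `w`. -/
def condMean (w : Treatment n → ℝ) (f : Treatment n → ℝ) : ℝ :=
  ∑ z ∈ Omega n, condProb w z * f z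

/-- Variance of `f` given `Ω`, for the weights `w`. -/
def condVar (w : Treatment n → ℝ) (f : Treatment n → ℝ) : ℝ :=
  condMean w fun z => (f z - condMean w f) ^ 2

/-- The unit cube of unmeasured confounders. -/
def unitCube (n : Fin B → ℕ) : Set (∀ i, Fin (n i) → ℝ) :=
  {u | ∀ i j, 0 ≤ u i j ∧ u i j ≤ 1}

/-- `u` is a hidden bias in the unit cube that maximizes the expectation of `Dbar`. -/
def WorstCase (r : Outcomes n) (Γ τ₀ : ℝ) (u : ∀ i, Fin (n i) → ℝ) : Prop :=
  u ∈ unitCube n ∧ ∀ v ∈ unitCube n,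
    condMean (biasWeight Γ v) (r.Dbar Γ τ₀) ≤ condMean (biasWeight Γ u) (r.Dbar Γ τ₀)

/-- The probability that the difference in means of set `i` is at least the average treatment
effect of that set. -/
def exceedProb (r : Outcomes n) (w : Treatment n → ℝ) (i : Fin B) : ℝ :=
  condMean w fun z => if r.setEffect i ≤ r.tauHat z i then 1 else 0

/-- The usual sample covariance. -/
def sampleCov (x y : Fin B → ℝ) : ℝ :=
  (∑ i, (x i - (∑ k, x k) / B) * (y i - (∑ k, y k) / B)) / ((B : ℝ) - 1)

/-- The sample covariance, over the matched sets, of the exceedance probabilities and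
`n i * (setEffect i - τ₀)`. -/
def biasCov (r : Outcomes n) (τ₀ : ℝ) (w : Treatment n → ℝ) : ℝ :=
  sampleCov (exceedProb r w) fun i => (n i : ℝ) * (r.setEffect i - τ₀)

/-- Lyapunov's ratio of exponent `2 + η` for `Dbar`. -/
def lyapunovRatio (r : Outcomes n) (Γ τ₀ : ℝ) (w : Treatment n → ℝ) (η : ℝ) : ℝ :=
  (∑ i, ((n i : ℝ) / total n) ^ (2 + η) *
    condMean w fun z => |r.D Γ τ₀ z i - condMean w fun z' => r.D Γ τ₀ z' i| ^ (2 + η)) /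
  condVar w (r.Dbar Γ τ₀) ^ (1 + η / 2)

/-- The hidden bias `u i j = 1` if the difference in means would be at least `τ₀` with individual
`j` treated, and `u i j = 0` otherwise. -/
def extremeBias (r : Outcomes n) (τ₀ : ℝ) (i : Fin B) (j : Fin (n i)) : ℝ :=
  if τ₀ ≤ r.diffIf i j then 1 else 0

end OneStudy

/-! ## Sequences of matched studies, indexed by the number `B` of matched sets -/

/-- A sequence of matched designs: the set sizes, all at least two, and a fixed matrix `Q` with `p`
columns for which the standard error is defined as soon as `p < B`. -/
structure Design (p : ℕ) where
  /-- set sizes -/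
  n : ∀ B : ℕ, Fin B → ℕ
  /-- covariates used for the standard error -/
  Q : ∀ B : ℕ, Matrix (Fin B) (Fin p) ℝ
  two_le : ∀ B i, 2 ≤ n B i
  isUnit_gram : ∀ B, p < B → IsUnit ((Q B).transpose * Q B)
  leverage_lt : ∀ B, p < B → ∀ i, hat (Q B) i i < 1

namespace Design

variable {p : ℕ} (d : Design p)

/-- One array of potential outcomes for each `B`. -/
abbrev OutcomeArray : Type := ∀ B : ℕ, Outcomes (d.n B)

/-- One real number for each individual, for each `B`. -/
abbrev UnitArray : Type := ∀ (B : ℕ) (i : Fin B), Fin (d.n B i) → ℝ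

variable (r : d.OutcomeArray) (prob : d.UnitArray)

/-- Rejection probability of the test given the potential outcomes and `Ω`, in the study with `B`
sets. -/
def size (Γ τ₀ α : ℝ) (B : ℕ) : ℝ :=
  condMean (assignWeight (prob B)) ((r B).test (d.Q B) Γ τ₀ α)

/-- Covariance condition on the true assignment mechanism, on the scale of the central limit
theorem. -/
def CondA (τ₀ : ℝ) : Prop :=
  0 ≤ liminf (fun B : ℕ => ((√(B : ℝ) * biasCov (r B) τ₀ (assignWeight (prob B)) : ℝ) : EReal))
    atTop

/-- Covariance condition on a hidden bias that yields the worst-case expectation, on the scale of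
the central limit theorem. -/
def CondB (Γ τ₀ : ℝ) : Prop :=
  ∃ u : d.UnitArray, (∀ B, WorstCase (r B) Γ τ₀ (u B)) ∧
    0 ≤ liminf (fun B : ℕ => ((√(B : ℝ) * biasCov (r B) τ₀ (biasWeight Γ (u B)) : ℝ) : EReal))
      atTop

/-- Regularity conditions: the variance of `√B` times the statistic stays away from zero, and
Lyapunov's condition holds. -/
def Regular (Γ τ₀ : ℝ) : Prop :=
  (∃ c : ℝ, 0 < c ∧ ∀ᶠ B : ℕ in atTop,
    c ≤ (B : ℝ) * condVar (assignWeight (prob B)) ((r B).Dbar Γ τ₀)) ∧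
  ∃ η : ℝ, 0 < η ∧
    Tendsto (fun B : ℕ => lyapunovRatio (r B) Γ τ₀ (assignWeight (prob B)) η) atTop (𝓝 0)

/-- Given `Ω`, treatment is assigned according to the hidden bias `extremeBias`. -/
def AssignedByExtremeBias (Γ τ₀ : ℝ) : Prop :=
  ∀ B, ∀ z ∈ Omega (d.n B),
    condProb (assignWeight (prob B)) z = condProb (biasWeight Γ (extremeBias (r B) τ₀)) z

end Design

end MatchedStudy

end

/-! Given one treated individual per set, Rosenbaum's model makes the sets independent, and within a
set the treatment probabilities differ by a factor of at most `Γ` (`SensModel.exists_hasIndepLaw`).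
The statistic is then a sum of independent terms, and the size is governed by its mean, its
fluctuations and the standard error.

Mean: `tilt` is concave, with slope `2 / (1 + Γ)` right of zero and `Γ` times that left of it. Hence
values summing to zero over a set have nonpositive tilted mean (`wmean_tilt_nonpos`), and mean zero
if the weights are in ratio `Γ : 1` according to sign (`wmean_tilt_eq_zero`). The differences in
means sum to zero when centred at the set's own average effect. Recentring at `τ₀` costs a term
affine in the exceedance probability (`tilt_add_le`), and under the weak null these costs add up to
a nonpositive multiple of the covariance (`HasIndepLaw.condMean_Dbar_le`). The covariance and
variance conditions make any positive part of the mean negligible against the standard deviation.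
Under (b) the true mean is first bounded by the worst-case mean.

Fluctuations: Lyapunov's condition gives Lindeberg's, and the central limit theorem follows by
comparing characteristic functions (`IsLindebergArray.tendsto_wprob`).

Standard error: the standardized residual vector is `W + q + R`, with `W` the centred terms, `q` a
fixed vector coming from the means, and `R` linear in `W`. The norm of `W` tends to one, `W` has a
small component along `q`, and `R` is small because the trace of the hat matrix is fixed. So the
standard error is never much too small, and it is consistent when all set means vanish
(`wprob_residualNorm_le`). Too large a standard error is harmless, as the critical value is
nonnegative for `α ≤ 1 / 2`.

If all set averages equal `τ₀`, both covariances vanish and `extremeBias` makes every set mean zero,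
so the size tends to `α`. The examples rescale each set by `total n / n i`, which removes the design
from the regularity conditions. -/

open Filter Topology

noncomputable section

namespace MatchedStudy

/-! ### Finite probability vectors and product laws -/

section FiniteLaws

/-- The sum of `f` weighted by `w`; the expectation of `f` when `w` is a probability vector. -/
def wmean {Ω : Type*} [Fintype Ω] (w f : Ω → ℝ) : ℝ := ∑ ω, w ω * f ω

open Classical in
/-- The probability of an event under the weights `w`. -/
def wprob {Ω : Type*} [Fintype Ω] (w : Ω → ℝ) (s : Ω → Prop) : ℝ :=
  wmean w fun ω => if s ω then 1 else 0

/-- Probability vectors. -/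
structure IsLaw {Ω : Type*} [Fintype Ω] (w : Ω → ℝ) : Prop where
  nonneg : ∀ ω, 0 ≤ w ω
  sum_eq_one : ∑ ω, w ω = 1

/-- Product weights. -/
def prodWeight {ι : Type*} [Fintype ι] {κ : ι → Type*} (p : ∀ i, κ i → ℝ) (t : ∀ i, κ i) : ℝ :=
  ∏ i, p i (t i)

section Basic

variable {Ω : Type*} [Fintype Ω] {w : Ω → ℝ}

theorem wmean_add (w f g : Ω → ℝ) : wmean w (fun x => f x + g x) = wmean w f + wmean w g := by
  simp [wmean, mul_add, Finset.sum_add_distrib]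

theorem wmean_sub (w f g : Ω → ℝ) : wmean w (fun x => f x - g x) = wmean w f - wmean w g := by
  simp [wmean, mul_sub, Finset.sum_sub_distrib]

theorem wmean_const_mul (w f : Ω → ℝ) (c : ℝ) : wmean w (fun x => c * f x) = c * wmean w f := by
  simp only [wmean, Finset.mul_sum]
  exact Finset.sum_congr rfl fun _ _ => by ring

theorem wmean_mul_const (w f : Ω → ℝ) (c : ℝ) : wmean w (fun x => f x * c) = wmean w f * c := by
  simp only [wmean, Finset.sum_mul]
  exact Finset.sum_congr rfl fun _ _ => by ring

theorem wmean_div_const (w f : Ω → ℝ) (c : ℝ) : wmean w (fun x => f x / c) = wmean w f / c := by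
  simp only [div_eq_mul_inv, wmean_mul_const]

theorem wmean_sum {ι : Type*} (s : Finset ι) (w : Ω → ℝ) (f : ι → Ω → ℝ) :
    wmean w (fun x => ∑ i ∈ s, f i x) = ∑ i ∈ s, wmean w (f i) := by
  simp only [wmean, Finset.mul_sum]
  exact Finset.sum_comm

theorem IsLaw.wmean_const (hw : IsLaw w) (c : ℝ) : wmean w (fun _ => c) = c := by
  simp [wmean, ← Finset.sum_mul, hw.sum_eq_one]

theorem IsLaw.wmean_mono (hw : IsLaw w) {f g : Ω → ℝ} (h : ∀ x, f x ≤ g x) :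
    wmean w f ≤ wmean w g :=
  Finset.sum_le_sum fun x _ => mul_le_mul_of_nonneg_left (h x) (hw.nonneg x)

theorem IsLaw.wmean_nonneg (hw : IsLaw w) {f : Ω → ℝ} (h : ∀ x, 0 ≤ f x) : 0 ≤ wmean w f :=
  Finset.sum_nonneg fun x _ => mul_nonneg (hw.nonneg x) (h x)

theorem IsLaw.sq_wmean_le (hw : IsLaw w) (f : Ω → ℝ) : wmean w f ^ 2 ≤ wmean w fun x => f x ^ 2 := by
  have h : 0 ≤ wmean w fun x => (f x - wmean w f) ^ 2 := hw.wmean_nonneg fun x => sq_nonneg _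
  have e : (fun x => (f x - wmean w f) ^ 2)
      = fun x => f x ^ 2 - ((2 * wmean w f) * f x - wmean w f ^ 2) := by ext x; ring
  rw [e, wmean_sub, wmean_sub, wmean_const_mul, hw.wmean_const] at h
  nlinarith

theorem IsLaw.wmean_sq_sub (hw : IsLaw w) (f : Ω → ℝ) :
    wmean w (fun x => (f x - wmean w f) ^ 2) ≤ wmean w fun x => f x ^ 2 := by
  have e : (fun x => (f x - wmean w f) ^ 2)
      = fun x => f x ^ 2 - ((2 * wmean w f) * f x - wmean w f ^ 2) := by ext x; ring
  rw [e, wmean_sub, wmean_sub, wmean_const_mul, hw.wmean_const]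
  nlinarith [sq_nonneg (wmean w f)]

theorem IsLaw.wmean_abs_le_sqrt (hw : IsLaw w) (f : Ω → ℝ) :
    wmean w (fun x => |f x|) ≤ √(wmean w fun x => f x ^ 2) := by
  refine Real.le_sqrt_of_sq_le ((hw.sq_wmean_le _).trans_eq ?_)
  simp only [sq_abs]

theorem wmean_ite_eq_wprob (w : Ω → ℝ) (s : Ω → Prop) [DecidablePred s] :
    wmean w (fun x => if s x then 1 else 0) = wprob w s := by
  unfold wprob
  congr! 3

theorem IsLaw.wprob_nonneg (hw : IsLaw w) (s : Ω → Prop) : 0 ≤ wprob w s :=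
  hw.wmean_nonneg fun x => by split_ifs <;> norm_num

theorem IsLaw.wprob_mono (hw : IsLaw w) {s t : Ω → Prop} (h : ∀ x, s x → t x) :
    wprob w s ≤ wprob w t := by
  classical
  refine hw.wmean_mono fun x => ?_
  by_cases hs : s x
  · simp [hs, h x hs]
  · simp only [hs, if_false]; split_ifs <;> norm_num

theorem IsLaw.wprob_or_le (hw : IsLaw w) (s t : Ω → Prop) :
    wprob w (fun x => s x ∨ t x) ≤ wprob w s + wprob w t := by
  classical
  unfold wprob
  rw [← wmean_add]
  refine hw.wmean_mono fun x => ?_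
  by_cases hs : s x <;> by_cases ht : t x <;> simp [hs, ht]

/-- Markov's inequality. -/
theorem IsLaw.wprob_le_div (hw : IsLaw w) {f : Ω → ℝ} (hf : ∀ x, 0 ≤ f x) {ε : ℝ} (hε : 0 < ε) :
    wprob w (fun x => ε < f x) ≤ wmean w f / ε := by
  classical
  rw [← wmean_div_const]
  refine hw.wmean_mono fun x => ?_
  split_ifs with h
  · rw [le_div_iff₀ hε]; linarith
  · exact div_nonneg (hf x) hε.le

end Basic

section Product

variable {ι : Type*} [Fintype ι] {κ : ι → Type*} [∀ i, Fintype (κ i)]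
  {p : ∀ i, κ i → ℝ}

theorem sum_prod_apply [DecidableEq ι] {R : Type*} [CommSemiring R] (a : ∀ i, κ i → R) :
    ∑ t : ∀ i, κ i, ∏ i, a i (t i) = ∏ i, ∑ j, a i j := by
  rw [Finset.prod_univ_sum, Fintype.piFinset_univ]

variable [DecidableEq ι]

theorem IsLaw.prodWeight (hp : ∀ i, IsLaw (p i)) : IsLaw (prodWeight p) where
  nonneg t := Finset.prod_nonneg fun i _ => (hp i).nonneg _
  sum_eq_one := by
    unfold MatchedStudy.prodWeight
    rw [sum_prod_apply]
    exact Finset.prod_eq_one fun i _ => (hp i).sum_eq_one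

theorem wmean_prodWeight (p g : ∀ i, κ i → ℝ) :
    wmean (prodWeight p) (fun t => ∏ i, g i (t i)) = ∏ i, wmean (p i) (g i) := by
  unfold wmean prodWeight
  rw [← sum_prod_apply]
  exact Finset.sum_congr rfl fun t _ => Finset.prod_mul_distrib.symm

theorem wmean_prodWeight_apply (hp : ∀ i, IsLaw (p i)) (g : ∀ i, κ i → ℝ) (i : ι) :
    wmean (prodWeight p) (fun t => g i (t i)) = wmean (p i) (g i) := by
  -- The other coordinates carry the factor one, whose mean is one.
  have h := wmean_prodWeight p (fun k x => if k = i then g k x else 1)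
  simp only [Finset.prod_ite_eq', Finset.mem_univ, if_true] at h
  rw [h, Finset.prod_eq_single i]
  · simp
  · intro k _ hk
    simp [hk, (hp k).wmean_const]
  · simp

theorem wmean_prodWeight_mul (hp : ∀ i, IsLaw (p i)) (g : ∀ i, κ i → ℝ) {i j : ι} (hij : i ≠ j) :
    wmean (prodWeight p) (fun t => g i (t i) * g j (t j))
      = wmean (p i) (g i) * wmean (p j) (g j) := by
  have h := wmean_prodWeight p (fun k x => if k = i ∨ k = j then g k x else 1)
  have e (f : ι → ℝ) : (∏ k, if k = i ∨ k = j then f k else 1) = f i * f j := by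
    rw [← Finset.prod_pair hij, ← Finset.prod_filter]
    congr 1
    ext k
    simp
  simp only [e] at h
  rw [h, ← e fun k => wmean (p k) (g k)]
  refine Finset.prod_congr rfl fun k _ => ?_
  split_ifs with hk
  · rfl
  · exact (hp k).wmean_const 1

/-- The second moment of a sum of independent centred variables. -/
theorem wmean_sq_sum (hp : ∀ i, IsLaw (p i)) (g : ∀ i, κ i → ℝ)
    (hg : ∀ i, wmean (p i) (g i) = 0) :
    wmean (prodWeight p) (fun t => (∑ i, g i (t i)) ^ 2)
      = ∑ i, wmean (p i) (fun x => g i x ^ 2) := by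
  simp_rw [sq (∑ i, g i _), Finset.sum_mul_sum, wmean_sum]
  refine Finset.sum_congr rfl fun i _ => ?_
  rw [Finset.sum_eq_single i]
  · simp_rw [← sq]
    exact wmean_prodWeight_apply hp (fun k x => g k x ^ 2) i
  · intro j _ hj
    rw [wmean_prodWeight_mul hp g hj.symm, hg, zero_mul]
  · simp

theorem wmean_sum_apply (hp : ∀ i, IsLaw (p i)) (g : ∀ i, κ i → ℝ) :
    wmean (prodWeight p) (fun t => ∑ i, g i (t i)) = ∑ i, wmean (p i) (g i) := by
  rw [wmean_sum]
  exact Finset.sum_congr rfl fun i _ => wmean_prodWeight_apply hp g i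

end Product

end FiniteLaws

/-! ### Lindeberg's theorem through characteristic functions -/

section CentralLimit

open MeasureTheory ProbabilityTheory

/-- The measure on the line that gives mass `w ω` to `f ω`. -/
def lawOf {Ω : Type*} [Fintype Ω] (w f : Ω → ℝ) : Measure ℝ :=
  ∑ ω, ENNReal.ofReal (w ω) • Measure.dirac (f ω)

theorem IsLaw.isProbabilityMeasure_lawOf {Ω : Type*} [Fintype Ω] {w : Ω → ℝ} (hw : IsLaw w)
    (f : Ω → ℝ) : IsProbabilityMeasure (lawOf w f) where
  measure_univ := by
    simp only [lawOf, Measure.coe_finsetSum, Finset.sum_apply, Measure.smul_apply, measure_univ,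
      smul_eq_mul, mul_one]
    rw [← ENNReal.ofReal_sum_of_nonneg fun i _ => hw.nonneg i, hw.sum_eq_one, ENNReal.ofReal_one]

theorem IsLaw.charFun_lawOf {Ω : Type*} [Fintype Ω] {w : Ω → ℝ} (hw : IsLaw w) (f : Ω → ℝ) (s : ℝ) :
    charFun (lawOf w f) s = ∑ ω, (w ω : ℂ) * Complex.exp (s * f ω * Complex.I) := by
  have hi (ω : Ω) : Integrable (fun x : ℝ => Complex.exp (s * x * Complex.I))
      (ENNReal.ofReal (w ω) • Measure.dirac (f ω)) :=
    (integrable_dirac (by simp [enorm_lt_top])).smul_measure ENNReal.ofReal_ne_top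
  rw [charFun_apply_real, lawOf, integral_finsetSum_measure fun ω _ => hi ω]
  refine Finset.sum_congr rfl fun ω _ => ?_
  rw [integral_smul_measure, integral_dirac, ENNReal.toReal_ofReal (hw.nonneg ω)]
  simp

theorem IsLaw.lawOf_Ici {Ω : Type*} [Fintype Ω] {w : Ω → ℝ} (hw : IsLaw w) (f : Ω → ℝ) (c : ℝ) :
    lawOf w f (Set.Ici c) = ENNReal.ofReal (wprob w fun ω => c ≤ f ω) := by
  classical
  simp only [lawOf, Measure.coe_finsetSum, Finset.sum_apply, Measure.smul_apply, smul_eq_mul,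
    Measure.dirac_apply' _ measurableSet_Ici]
  unfold wprob wmean
  rw [ENNReal.ofReal_sum_of_nonneg]
  · refine Finset.sum_congr rfl fun ω _ => ?_
    by_cases h : c ≤ f ω <;> simp [h]
  · intro ω _
    exact mul_nonneg (hw.nonneg ω) (by dsimp only; split_ifs <;> norm_num)

/-- Exchange the factors one at a time: all the others lie in the unit disc, so each exchange costs
at most its own difference. -/
theorem norm_prod_sub_prod_le {ι : Type*} (s : Finset ι) (a b : ι → ℂ) (ha : ∀ i, ‖a i‖ ≤ 1)
    (hb : ∀ i, ‖b i‖ ≤ 1) : ‖∏ i ∈ s, a i - ∏ i ∈ s, b i‖ ≤ ∑ i ∈ s, ‖a i - b i‖ := by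
  classical
  induction s using Finset.induction_on with
  | empty => simp
  | insert k s hk ih =>
    rw [Finset.prod_insert hk, Finset.prod_insert hk, Finset.sum_insert hk]
    have e : a k * ∏ i ∈ s, a i - b k * ∏ i ∈ s, b i
        = (a k - b k) * ∏ i ∈ s, a i + b k * (∏ i ∈ s, a i - ∏ i ∈ s, b i) := by ring
    have h1 : ‖∏ i ∈ s, a i‖ ≤ 1 := by
      rw [norm_prod]
      exact Finset.prod_le_one (fun i _ => norm_nonneg _) fun i _ => ha i
    rw [e]
    refine (norm_add_le _ _).trans (add_le_add ?_ ?_)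
    · rw [norm_mul]
      exact mul_le_of_le_one_right (norm_nonneg _) h1
    · rw [norm_mul]
      exact (mul_le_of_le_one_left (norm_nonneg _) (hb k)).trans ih

/-- The cubic bound serves small arguments, the quadratic one the tail. The crude constant 4 covers
both the Taylor remainder for `|x| ≤ 1` and the triangle inequality beyond. -/
theorem norm_exp_taylor_two_le (x : ℝ) :
    ‖Complex.exp (x * Complex.I) - (1 + x * Complex.I - x ^ 2 / 2)‖ ≤ 4 * |x| ^ 3 ∧
    ‖Complex.exp (x * Complex.I) - (1 + x * Complex.I - x ^ 2 / 2)‖ ≤ 4 * x ^ 2 := by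
  have hI : ‖(x : ℂ) * Complex.I‖ = |x| := by simp
  rcases le_total |x| 1 with h | h
  · have h3 := Complex.exp_bound (x := (x : ℂ) * Complex.I) (by rwa [hI]) (n := 3) (by norm_num)
    have e : ∑ m ∈ Finset.range 3, ((x : ℂ) * Complex.I) ^ m / (m.factorial : ℂ)
        = 1 + x * Complex.I - x ^ 2 / 2 := by
      simp [Finset.sum_range_succ, mul_pow, Nat.factorial]
      ring
    rw [e, hI] at h3
    have hx := abs_nonneg x
    have h4 : ‖Complex.exp (x * Complex.I) - (1 + x * Complex.I - x ^ 2 / 2)‖ ≤ 4 * |x| ^ 3 := by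
      refine h3.trans ?_
      rw [mul_comm]
      gcongr
      norm_num [Nat.factorial]
    refine ⟨h4, h4.trans ?_⟩
    rw [← sq_abs x]
    nlinarith [sq_nonneg |x|]
  · have h4 : ‖Complex.exp (x * Complex.I) - (1 + x * Complex.I - x ^ 2 / 2)‖ ≤ 4 * x ^ 2 := by
      have h5 : ‖(x : ℂ) ^ 2 / 2‖ = x ^ 2 / 2 := by
        rw [norm_div, norm_pow, Complex.norm_real, Real.norm_eq_abs, sq_abs]; simp
      calc ‖Complex.exp (x * Complex.I) - (1 + x * Complex.I - x ^ 2 / 2)‖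
          ≤ ‖Complex.exp (x * Complex.I)‖ + (‖(1 : ℂ)‖ + ‖(x : ℂ) * Complex.I‖
            + ‖(x : ℂ) ^ 2 / 2‖) := by
            refine (norm_sub_le _ _).trans ?_
            gcongr
            refine (norm_sub_le _ _).trans ?_
            gcongr
            exact norm_add_le _ _
        _ ≤ 4 * x ^ 2 := by
            rw [Complex.norm_exp_ofReal_mul_I, hI, h5, norm_one, ← sq_abs x]
            nlinarith
    refine ⟨h4.trans ?_, h4⟩
    rw [← sq_abs x]
    nlinarith [sq_nonneg |x|]

/-- The tail second moment in Lindeberg's condition. -/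
def tailSq {Ω : Type*} [Fintype Ω] (w X : Ω → ℝ) (δ : ℝ) : ℝ :=
  wmean w fun x => if δ < |X x| then X x ^ 2 else 0

theorem IsLaw.tailSq_nonneg {Ω : Type*} [Fintype Ω] {w : Ω → ℝ} (hw : IsLaw w) (X : Ω → ℝ) (δ : ℝ) :
    0 ≤ tailSq w X δ :=
  hw.wmean_nonneg fun x => by split_ifs <;> positivity

/-- Lindeberg's condition thereby makes all variances of a row uniformly small. -/
theorem IsLaw.wmean_sq_le_tailSq {Ω : Type*} [Fintype Ω] {w : Ω → ℝ} (hw : IsLaw w) (X : Ω → ℝ)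
    (δ : ℝ) : (wmean w fun x => X x ^ 2) ≤ δ ^ 2 + tailSq w X δ := by
  have h := hw.wmean_mono (f := fun x => X x ^ 2)
    (g := fun x => δ ^ 2 + if δ < |X x| then X x ^ 2 else 0) fun x => by
      split_ifs with h
      · nlinarith [sq_nonneg δ]
      · rw [add_zero, ← sq_abs]
        exact pow_le_pow_left₀ (abs_nonneg _) (not_lt.1 h) 2
  rwa [wmean_add, hw.wmean_const] at h

/-- The linear Taylor term vanishes by centring. The cubic remainder is used where `|X| ≤ δ`, the
quadratic one where `|X| > δ`. -/
theorem IsLaw.norm_charFun_sub_le {Ω : Type*} [Fintype Ω] {w : Ω → ℝ} (hw : IsLaw w) {X : Ω → ℝ}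
    (hX : wmean w X = 0) (s : ℝ) {δ : ℝ} (hδ : 0 ≤ δ) :
    ‖∑ ω, (w ω : ℂ) * Complex.exp (s * X ω * Complex.I)
      - ((1 - s ^ 2 * (wmean w fun x => X x ^ 2) / 2 : ℝ) : ℂ)‖
    ≤ 4 * |s| ^ 3 * δ * (wmean w fun x => X x ^ 2) + 4 * s ^ 2 * tailSq w X δ := by
  have e : ((1 - s ^ 2 * (wmean w fun x => X x ^ 2) / 2 : ℝ) : ℂ)
      = ∑ ω, (w ω : ℂ) * (1 + (s * X ω : ℝ) * Complex.I - ((s * X ω : ℝ) : ℂ) ^ 2 / 2) := by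
    have h1 : ∑ ω, (w ω : ℂ) = 1 := by exact_mod_cast hw.sum_eq_one
    have h2 : ∑ ω, (w ω : ℂ) * X ω = 0 := by exact_mod_cast hX
    calc ((1 - s ^ 2 * (wmean w fun x => X x ^ 2) / 2 : ℝ) : ℂ)
        = ∑ ω, (w ω : ℂ) + s * Complex.I * ∑ ω, (w ω : ℂ) * X ω
          - s ^ 2 / 2 * ∑ ω, (w ω : ℂ) * (X ω : ℂ) ^ 2 := by
          rw [h1, h2, wmean]; push_cast; ring
      _ = _ := by
          rw [Finset.mul_sum, Finset.mul_sum, ← Finset.sum_add_distrib, ← Finset.sum_sub_distrib]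
          refine Finset.sum_congr rfl fun ω _ => ?_
          push_cast
          ring
  rw [e, ← Finset.sum_sub_distrib]
  unfold tailSq
  rw [← wmean_const_mul, ← wmean_const_mul, ← wmean_add]
  refine (norm_sum_le _ _).trans (Finset.sum_le_sum fun ω _ => ?_)
  rw [← mul_sub, norm_mul, Complex.norm_real, Real.norm_eq_abs, abs_of_nonneg (hw.nonneg ω)]
  refine mul_le_mul_of_nonneg_left ?_ (hw.nonneg ω)
  obtain ⟨h3, h2⟩ := norm_exp_taylor_two_le (s * X ω)
  rw [← Complex.ofReal_mul]
  dsimp only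
  split_ifs with h
  · refine h2.trans ?_
    have : 0 ≤ 4 * |s| ^ 3 * δ * X ω ^ 2 := by positivity
    nlinarith
  · refine h3.trans ?_
    rw [abs_mul, ← sq_abs (X ω), mul_zero, add_zero]
    have : 4 * (|s| * |X ω|) ^ 3 = 4 * |s| ^ 3 * |X ω| * |X ω| ^ 2 := by ring
    rw [this]
    gcongr
    exact not_lt.1 h

/-- The hypotheses of Lindeberg's theorem for a triangular array of independent variables, the
`B`-th row of which is normalised to variance one for large `B`. -/
structure IsLindebergArray {n : ∀ B : ℕ, Fin B → ℕ} (p X : ∀ B i, Fin (n B i) → ℝ) : Prop where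
  law : ∀ B i, IsLaw (p B i)
  centred : ∀ B i, wmean (p B i) (X B i) = 0
  variance : ∀ᶠ B in atTop, ∑ i, wmean (p B i) (fun x => X B i x ^ 2) = 1
  lindeberg : ∀ δ > 0, Tendsto (fun B => ∑ i, tailSq (p B i) (X B i) δ) atTop (𝓝 0)

theorem abs_exp_neg_sub_le {a : ℝ} (ha : 0 ≤ a) : |Real.exp (-a) - (1 - a)| ≤ a ^ 2 := by
  have h1 := Real.add_one_le_exp (-a)
  have h2 : Real.exp (-a) ≤ 1 / (1 + a) := by
    rw [Real.exp_neg, ← one_div]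
    exact one_div_le_one_div_of_le (by linarith) (by linarith [Real.add_one_le_exp a])
  have h3 : 1 / (1 + a) ≤ 1 - a + a ^ 2 := by
    rw [div_le_iff₀ (by linarith)]
    nlinarith [pow_nonneg ha 3]
  rw [abs_of_nonneg (by linarith)]
  linarith

/-- Since the variances sum to one, the Gaussian characteristic function is itself a product of
factors `exp (-s ^ 2 * v i / 2)`, and the two products can be compared factor by factor. -/
theorem norm_prod_charFun_sub_le {ι : Type*} [Fintype ι] {κ : ι → Type*} [∀ i, Fintype (κ i)]
    {p X : ∀ i, κ i → ℝ} (hp : ∀ i, IsLaw (p i)) (hX : ∀ i, wmean (p i) (X i) = 0)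
    (hv : ∑ i, wmean (p i) (fun x => X i x ^ 2) = 1) (s : ℝ) {δ : ℝ} (hδ : 0 < δ) :
    ‖∏ i, (∑ j, (p i j : ℂ) * Complex.exp (s * X i j * Complex.I))
      - Complex.exp (-s ^ 2 / 2)‖
    ≤ 4 * |s| ^ 3 * δ + 4 * s ^ 2 * ∑ i, tailSq (p i) (X i) δ
      + s ^ 4 * (δ ^ 2 + ∑ i, tailSq (p i) (X i) δ) := by
  set v : ι → ℝ := fun i => wmean (p i) (fun x => X i x ^ 2) with hvdef
  have hv0 (i) : 0 ≤ v i := (hp i).wmean_nonneg fun x => sq_nonneg _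
  have hL0 (i) : 0 ≤ tailSq (p i) (X i) δ := (hp i).tailSq_nonneg _ _
  have e : Complex.exp (-s ^ 2 / 2) = ∏ i, ((Real.exp (-(s ^ 2 * v i / 2)) : ℝ) : ℂ) := by
    rw [← Complex.ofReal_prod, ← Real.exp_sum]
    have : ∑ i, -(s ^ 2 * v i / 2) = -s ^ 2 / 2 := by
      rw [Finset.sum_neg_distrib, ← Finset.sum_div, ← Finset.mul_sum, hv]
      ring
    rw [this]
    push_cast
    rfl
  rw [e]
  refine (norm_prod_sub_prod_le _ _ _ (fun i => ?_) fun i => ?_).trans ?_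
  · refine (norm_sum_le _ _).trans_eq ?_
    rw [← (hp i).sum_eq_one]
    refine Finset.sum_congr rfl fun j _ => ?_
    rw [norm_mul, ← Complex.ofReal_mul, Complex.norm_exp_ofReal_mul_I, Complex.norm_real,
      Real.norm_eq_abs, abs_of_nonneg ((hp i).nonneg j), mul_one]
  · rw [Complex.norm_real, Real.norm_eq_abs, Real.abs_exp, Real.exp_le_one_iff]
    have := hv0 i
    have : 0 ≤ s ^ 2 * v i / 2 := by positivity
    linarith
  have hb (i) : ‖∑ j, (p i j : ℂ) * Complex.exp (s * X i j * Complex.I)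
      - ((Real.exp (-(s ^ 2 * v i / 2)) : ℝ) : ℂ)‖
      ≤ 4 * |s| ^ 3 * δ * v i + 4 * s ^ 2 * tailSq (p i) (X i) δ
        + s ^ 4 * (δ ^ 2 + ∑ i, tailSq (p i) (X i) δ) * v i := by
    have h1 := (hp i).norm_charFun_sub_le (hX i) s hδ.le
    have h2 : ‖((1 - s ^ 2 * v i / 2 : ℝ) : ℂ) - ((Real.exp (-(s ^ 2 * v i / 2)) : ℝ) : ℂ)‖
        ≤ s ^ 4 * (δ ^ 2 + ∑ i, tailSq (p i) (X i) δ) * v i := by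
      have := hv0 i
      rw [← Complex.ofReal_sub, Complex.norm_real, Real.norm_eq_abs, abs_sub_comm]
      refine (abs_exp_neg_sub_le (by positivity)).trans ?_
      -- In `v i ^ 2` one factor is bounded uniformly in `i`; the other is kept, to be summed to
      -- one.
      have h3 : v i ≤ δ ^ 2 + ∑ i, tailSq (p i) (X i) δ :=
        ((hp i).wmean_sq_le_tailSq (X i) δ).trans
          (add_le_add le_rfl (Finset.single_le_sum (fun i _ => hL0 i) (Finset.mem_univ i)))
      calc (s ^ 2 * v i / 2) ^ 2 = s ^ 4 / 4 * v i * v i := by ring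
        _ ≤ s ^ 4 * (δ ^ 2 + ∑ i, tailSq (p i) (X i) δ) * v i := by
          gcongr
          have : 0 ≤ s ^ 4 := by positivity
          linarith
    exact (norm_sub_le_norm_sub_add_norm_sub _ _ _).trans (add_le_add h1 h2)
  refine (Finset.sum_le_sum fun i _ => hb i).trans_eq ?_
  rw [Finset.sum_add_distrib, Finset.sum_add_distrib, ← Finset.mul_sum, ← Finset.mul_sum,
    ← Finset.mul_sum, hv]
  ring

theorem IsLindebergArray.tendsto_charFun {n : ∀ B : ℕ, Fin B → ℕ} {p X : ∀ B i, Fin (n B i) → ℝ}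
    (h : IsLindebergArray p X) (s : ℝ) :
    Tendsto (fun B => charFun (lawOf (prodWeight (p B)) fun t => ∑ i, X B i (t i)) s) atTop
      (𝓝 (Complex.exp (-s ^ 2 / 2))) := by
  have e (B) : charFun (lawOf (prodWeight (p B)) fun t => ∑ i, X B i (t i)) s
      = ∏ i, (∑ j, (p B i j : ℂ) * Complex.exp (s * X B i j * Complex.I)) := by
    rw [(IsLaw.prodWeight (h.law B)).charFun_lawOf, ← sum_prod_apply]
    refine Finset.sum_congr rfl fun t _ => ?_
    rw [Finset.prod_mul_distrib, prodWeight, ← Complex.exp_sum]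
    push_cast
    rw [Finset.mul_sum, Finset.sum_mul]
  simp_rw [e]
  refine Metric.tendsto_nhds.2 fun ε hε => ?_
  -- The zeros stand for the limits of the tail sums: `δ` is fixed first, and only then does `B`
  -- grow.
  have h0 : Tendsto (fun δ : ℝ => 4 * |s| ^ 3 * δ + 4 * s ^ 2 * 0 + s ^ 4 * (δ ^ 2 + 0)) (𝓝[>] 0)
      (𝓝 0) := by
    have : ContinuousAt (fun δ : ℝ => 4 * |s| ^ 3 * δ + 4 * s ^ 2 * 0 + s ^ 4 * (δ ^ 2 + 0)) 0 := by
      fun_prop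
    simpa using this.tendsto.mono_left nhdsWithin_le_nhds
  obtain ⟨δ, hδε, hδ⟩ := ((h0.eventually_lt_const hε).and self_mem_nhdsWithin).exists
  have h1 := ((((h.lindeberg δ hδ).const_mul (4 * s ^ 2)).const_add (4 * |s| ^ 3 * δ)).add
    (((h.lindeberg δ hδ).const_add (δ ^ 2)).const_mul (s ^ 4))).eventually_lt_const hδε
  filter_upwards [h1, h.variance] with B hB hv
  rw [dist_eq_norm]
  exact (norm_prod_charFun_sub_le (h.law B) (h.centred B) hv s hδ).trans_lt hB

/-- **Lindeberg's central limit theorem.** -/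
theorem IsLindebergArray.tendsto_wprob {n : ∀ B : ℕ, Fin B → ℕ} {p X : ∀ B i, Fin (n B i) → ℝ}
    (h : IsLindebergArray p X) (c : ℝ) :
    Tendsto (fun B => wprob (prodWeight (p B)) fun t => c ≤ ∑ i, X B i (t i)) atTop
      (𝓝 (1 - cdf (gaussianReal 0 1) c)) := by
  have hl (B) := IsLaw.prodWeight (h.law B)
  let μ (B : ℕ) : ProbabilityMeasure ℝ :=
    ⟨lawOf (prodWeight (p B)) fun t => ∑ i, X B i (t i), (hl B).isProbabilityMeasure_lawOf _⟩
  have := nullSingletonClass_gaussianReal (μ := 0) (v := 1) one_ne_zero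
  let g : ProbabilityMeasure ℝ := ⟨gaussianReal 0 1, inferInstance⟩
  have hμ : Tendsto μ atTop (𝓝 g) := by
    refine ProbabilityMeasure.tendsto_iff_tendsto_charFun.2 fun s => ?_
    have : charFun (g : Measure ℝ) s = Complex.exp (-s ^ 2 / 2) := by
      simp [g, charFun_gaussianReal, neg_div]
    rw [this]
    exact h.tendsto_charFun s
  -- The boundary of the half-line is a single point, which the Gaussian law does not charge.
  have h1 := ProbabilityMeasure.tendsto_measure_of_null_frontier_of_tendsto' hμ
    (E := Set.Ici c) (by simp [g])
  have h2 := (ENNReal.tendsto_toReal (measure_ne_top _ _)).comp h1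
  have e1 : ((g : Measure ℝ) (Set.Ici c)).toReal = 1 - cdf (gaussianReal 0 1) c := by
    change (gaussianReal 0 1).real (Set.Ici c) = _
    rw [cdf_eq_real, ← probReal_compl_eq_one_sub measurableSet_Iic, Set.compl_Iic]
    exact measureReal_congr Ioi_ae_eq_Ici.symm
  rw [e1] at h2
  refine h2.congr fun B => ?_
  change (lawOf _ _ (Set.Ici c)).toReal = _
  rw [(hl B).lawOf_Ici, ENNReal.toReal_ofReal ((hl B).wprob_nonneg _)]

end CentralLimit

/-! ### Projections, leverages and residuals -/

section HatMatrix

variable {B k : ℕ} {Q : Matrix (Fin B) (Fin k) ℝ}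

theorem hat_transpose (Q : Matrix (Fin B) (Fin k) ℝ) : (hat Q).transpose = hat Q := by
  simp [hat, Matrix.transpose_mul, Matrix.transpose_nonsing_inv, Matrix.mul_assoc]

theorem hat_mul_self (hQ : IsUnit (Q.transpose * Q)) : hat Q * hat Q = hat Q := by
  have h := Matrix.nonsing_inv_mul _ ((Matrix.isUnit_iff_isUnit_det _).1 hQ)
  calc hat Q * hat Q
      = Q * (((Q.transpose * Q)⁻¹ * (Q.transpose * Q)) * (Q.transpose * Q)⁻¹) * Q.transpose := by
        simp only [hat, Matrix.mul_assoc]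
    _ = hat Q := by rw [h, Matrix.one_mul, hat]

theorem sum_hat_diag (hQ : IsUnit (Q.transpose * Q)) : ∑ i, hat Q i i = k := by
  have h := Matrix.mul_nonsing_inv _ ((Matrix.isUnit_iff_isUnit_det _).1 hQ)
  change (hat Q).trace = k
  rw [hat, Matrix.trace_mul_comm, ← Matrix.mul_assoc, h]
  simp

theorem sum_sq_of_projection {M : Matrix (Fin B) (Fin B) ℝ} (ht : M.transpose = M)
    (hM : M * M = M) (i : Fin B) : ∑ l, M l i ^ 2 = M i i := by
  conv_rhs => rw [← hM, Matrix.mul_apply]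
  refine Finset.sum_congr rfl fun l _ => ?_
  rw [sq]
  congr 1
  conv_lhs => rw [← ht]
  rfl

theorem dotProduct_mulVec_of_projection {M : Matrix (Fin B) (Fin B) ℝ} (ht : M.transpose = M)
    (hM : M * M = M) (y : Fin B → ℝ) : y ⬝ᵥ M.mulVec y = ∑ l, M.mulVec y l ^ 2 := by
  conv_lhs => rw [← hM, ← Matrix.mulVec_mulVec, Matrix.dotProduct_mulVec, ← Matrix.mulVec_transpose,
    ht]
  simp [dotProduct, sq]

theorem one_sub_hat_transpose (Q : Matrix (Fin B) (Fin k) ℝ) :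
    (1 - hat Q).transpose = 1 - hat Q := by
  rw [Matrix.transpose_sub, hat_transpose, Matrix.transpose_one]

theorem one_sub_hat_mul_self (hQ : IsUnit (Q.transpose * Q)) :
    (1 - hat Q) * (1 - hat Q) = 1 - hat Q := by
  simp [Matrix.mul_sub, Matrix.sub_mul, hat_mul_self hQ]

theorem hat_diag_nonneg (hQ : IsUnit (Q.transpose * Q)) (i : Fin B) : 0 ≤ hat Q i i := by
  rw [← sum_sq_of_projection (hat_transpose Q) (hat_mul_self hQ)]
  positivity

/-- The matrix `(1 - H) diag(1 - h)^(-1/2) - 1`. -/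
def residualError (Q : Matrix (Fin B) (Fin k) ℝ) (l i : Fin B) : ℝ :=
  (1 - hat Q) l i / √(1 - hat Q i i) - (1 : Matrix (Fin B) (Fin B) ℝ) l i

/-- With `a = √(1 - h)`, the vector is a projection column of norm `a` divided by `a`, minus a basis
vector. Its squared norm is `2 - 2 * a`, and `a ≥ a ^ 2 = 1 - h`. -/
theorem sum_sq_residualError_le (hQ : IsUnit (Q.transpose * Q)) (i : Fin B) (hi : hat Q i i < 1) :
    ∑ l, residualError Q l i ^ 2 ≤ 2 * hat Q i i := by
  have h0 := hat_diag_nonneg hQ i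
  set a := √(1 - hat Q i i) with ha
  have ha0 : 0 < a := Real.sqrt_pos.2 (by linarith)
  have ha2 : a ^ 2 = 1 - hat Q i i := Real.sq_sqrt (by linarith)
  have hs := sum_sq_of_projection (one_sub_hat_transpose Q) (one_sub_hat_mul_self hQ) i
  have hii : (1 - hat Q) i i = a ^ 2 := by rw [ha2]; simp
  have e : ∑ l, residualError Q l i ^ 2
      = (∑ l, (1 - hat Q) l i ^ 2) / a ^ 2 - 2 * ((1 - hat Q) i i / a) + 1 := by
    have e1 (l : Fin B) : residualError Q l i ^ 2 = (1 - hat Q) l i ^ 2 / a ^ 2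
        + if l = i then 1 - 2 * ((1 - hat Q) l i / a) else 0 := by
      unfold residualError
      rw [Matrix.one_apply, ← ha]
      split_ifs <;> ring
    simp_rw [e1, Finset.sum_add_distrib, ← Finset.sum_div, Finset.sum_ite_eq', Finset.mem_univ,
      if_true]
    ring
  have e2 : a ^ 2 / a = a := by field_simp
  rw [e, hs, hii, div_self (by positivity), e2]
  nlinarith

/-- This isolates the noise itself, a nonrandom vector due to the means, and an error linear in the
noise whose coefficients are controlled by the leverages. -/
theorem residual_eq (Q : Matrix (Fin B) (Fin k) ℝ) (W m : Fin B → ℝ) (l : Fin B) :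
    (1 - hat Q).mulVec (fun i => (W i + m i) / √(1 - hat Q i i)) l
      = W l + (1 - hat Q).mulVec (fun i => m i / √(1 - hat Q i i)) l
        + ∑ i, residualError Q l i * W i := by
  have e : W l = ∑ i, (1 : Matrix (Fin B) (Fin B) ℝ) l i * W i := by
    simp [Matrix.one_apply]
  conv_rhs => rw [e]
  simp only [Matrix.mulVec, dotProduct, residualError, ← Finset.sum_add_distrib]
  exact Finset.sum_congr rfl fun i _ => by ring

end HatMatrix

/-! ### Norm estimates for a perturbed vector -/

section Euclid

variable {ι : Type*} [Fintype ι]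

theorem sqrt_sum_sq_eq_norm (u : ι → ℝ) : √(∑ i, u i ^ 2) = ‖WithLp.toLp 2 u‖ := by
  simp [EuclideanSpace.norm_eq]

theorem sqrt_sum_sq_add_le (u v : ι → ℝ) :
    √(∑ i, (u i + v i) ^ 2) ≤ √(∑ i, u i ^ 2) + √(∑ i, v i ^ 2) := by
  have := norm_add_le (WithLp.toLp 2 u) (WithLp.toLp 2 v)
  rw [← WithLp.toLp_add, ← sqrt_sum_sq_eq_norm, ← sqrt_sum_sq_eq_norm, ← sqrt_sum_sq_eq_norm] at this
  exact this

/-- For `q = 0` the division by zero yields `e = 0`; hence the inequality instead of norm one. -/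
theorem exists_unit_direction (q : ι → ℝ) :
    ∃ e : ι → ℝ, ∑ i, e i ^ 2 ≤ 1 ∧ ∀ i, q i = √(∑ i, q i ^ 2) * e i := by
  set r := √(∑ i, q i ^ 2) with hr
  have hr2 : r ^ 2 = ∑ i, q i ^ 2 := Real.sq_sqrt (by positivity)
  refine ⟨fun i => q i / r, ?_, fun i => ?_⟩
  · simp_rw [div_pow, ← Finset.sum_div, ← hr2]
    exact div_self_le_one _
  · rcases eq_or_ne r 0 with h | h
    · have : q i ^ 2 ≤ r ^ 2 := by
        rw [hr2]
        exact Finset.single_le_sum (f := fun i => q i ^ 2) (fun i _ => sq_nonneg _)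
          (Finset.mem_univ i)
      rw [h] at this ⊢
      nlinarith
    · field_simp

/-- No bound on `q` is needed: its cross term with `W` is at least `-2 * r * ε`, where `r` is the
norm of `q`, and `r ^ 2` absorbs this up to `ε ^ 2`. -/
theorem sqrt_sum_sq_lower {W q e R : ι → ℝ} {ε : ℝ} (hε : 0 < ε)
    (he : ∀ i, q i = √(∑ i, q i ^ 2) * e i) (hW : |∑ i, W i ^ 2 - 1| ≤ ε)
    (hqW : (∑ i, e i * W i) ^ 2 ≤ ε ^ 2) (hR : ∑ i, R i ^ 2 ≤ ε ^ 2) :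
    1 - 3 * ε ≤ √(∑ i, (W i + q i + R i) ^ 2) := by
  rcases lt_or_ge (1 : ℝ) (3 * ε) with h1 | h1
  · exact le_trans (by linarith) (Real.sqrt_nonneg _)
  set r := √(∑ i, q i ^ 2) with hr
  have hr0 : 0 ≤ r := Real.sqrt_nonneg _
  have hr2 : r ^ 2 = ∑ i, q i ^ 2 := Real.sq_sqrt (by positivity)
  have hc : |∑ i, e i * W i| ≤ ε := abs_le_of_sq_le_sq hqW hε.le
  have e1 : ∑ i, (W i + q i) ^ 2 = ∑ i, W i ^ 2 + 2 * r * ∑ i, e i * W i + r ^ 2 := by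
    rw [hr2, Finset.mul_sum, ← Finset.sum_add_distrib, ← Finset.sum_add_distrib]
    refine Finset.sum_congr rfl fun i _ => ?_
    have := he i
    linear_combination 2 * W i * this
  -- Completing the square leaves `1 - ε - ε ^ 2`, which is at least `(1 - 2 * ε) ^ 2` because `3 *
  -- ε ≤ 1`.
  have h2 : (1 - 2 * ε) ^ 2 ≤ ∑ i, (W i + q i) ^ 2 := by
    rw [e1]
    have := (abs_le.1 hW).1
    have h3 : -(r * ε) ≤ r * ∑ i, e i * W i := by
      have := mul_le_mul_of_nonneg_left (abs_le.1 hc).1 hr0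
      linarith
    nlinarith [sq_nonneg (r - ε)]
  have h3 : 1 - 2 * ε ≤ √(∑ i, (W i + q i) ^ 2) := Real.le_sqrt_of_sq_le h2
  have h4 := sqrt_sum_sq_add_le (fun i => W i + q i + R i) (fun i => -R i)
  simp only [add_neg_cancel_right, neg_sq] at h4
  have h5 : √(∑ i, R i ^ 2) ≤ ε := Real.sqrt_le_iff.2 ⟨hε.le, hR⟩
  linarith

theorem sqrt_sum_sq_upper {W R : ι → ℝ} {ε : ℝ} (hε : 0 < ε)
    (hW : |∑ i, W i ^ 2 - 1| ≤ ε) (hR : ∑ i, R i ^ 2 ≤ ε ^ 2) :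
    √(∑ i, (W i + R i) ^ 2) ≤ 1 + 3 * ε := by
  have h5 : √(∑ i, R i ^ 2) ≤ ε := Real.sqrt_le_iff.2 ⟨hε.le, hR⟩
  have h6 : √(∑ i, W i ^ 2) ≤ 1 + ε :=
    Real.sqrt_le_iff.2 ⟨by linarith, by nlinarith [(abs_le.1 hW).2]⟩
  have h4 := sqrt_sum_sq_add_le W R
  linarith

end Euclid

/-! ### Weak law for the sum of squares, and variances of linear forms -/

section SecondMoments

variable {ι : Type*} [Fintype ι] [DecidableEq ι] {κ : ι → Type*} [∀ i, Fintype (κ i)]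
  {p X : ∀ i, κ i → ℝ}

/-- A weak law by truncation, needing no fourth moments: squares with `|X| ≤ δ` are controlled
through their variance, and the rest enters only through its mean, once for itself and once for its
centring. -/
theorem wmean_abs_sum_sq_sub_one_le (hp : ∀ i, IsLaw (p i))
    (hv : ∑ i, wmean (p i) (fun x => X i x ^ 2) = 1) {δ : ℝ} (hδ : 0 ≤ δ) :
    wmean (prodWeight p) (fun t => |∑ i, X i (t i) ^ 2 - 1|)
      ≤ δ + 2 * ∑ i, tailSq (p i) (X i) δ := by
  have hP := IsLaw.prodWeight hp
  set T : ∀ i, κ i → ℝ := fun i x => if δ < |X i x| then 0 else X i x ^ 2 with hT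
  set U : ∀ i, κ i → ℝ := fun i x => if δ < |X i x| then X i x ^ 2 else 0 with hU
  have hTU (i x) : X i x ^ 2 = T i x + U i x := by simp only [hT, hU]; split_ifs <;> simp
  have hU0 (i x) : 0 ≤ U i x := by simp only [hU]; split_ifs <;> positivity
  have hEU (i) : wmean (p i) (U i) = tailSq (p i) (X i) δ := rfl
  have hT2 (i x) : T i x ^ 2 ≤ δ ^ 2 * X i x ^ 2 := by
    simp only [hT]
    split_ifs with h
    · rw [zero_pow two_ne_zero]
      positivity
    · rw [sq (X i x ^ 2)]
      refine mul_le_mul_of_nonneg_right ?_ (sq_nonneg _)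
      rw [← sq_abs (X i x)]
      exact pow_le_pow_left₀ (abs_nonneg _) (not_lt.1 h) 2
  have h1 : ∑ i, wmean (p i) (T i) + ∑ i, wmean (p i) (U i) = 1 := by
    rw [← hv, ← Finset.sum_add_distrib]
    refine Finset.sum_congr rfl fun i _ => ?_
    rw [← wmean_add]
    simp only [hTU]
  have hpt (t : ∀ i, κ i) : |∑ i, X i (t i) ^ 2 - 1|
      ≤ |∑ i, (T i (t i) - wmean (p i) (T i))| + (∑ i, U i (t i) + ∑ i, tailSq (p i) (X i) δ) := by
    have h2 : ∑ i, X i (t i) ^ 2 - 1 = ∑ i, (T i (t i) - wmean (p i) (T i))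
        + (∑ i, U i (t i) - ∑ i, wmean (p i) (U i)) := by
      simp only [hTU, Finset.sum_add_distrib, Finset.sum_sub_distrib]
      linarith
    have h3 : 0 ≤ ∑ i, U i (t i) := Finset.sum_nonneg fun i _ => hU0 i _
    have h4 : 0 ≤ ∑ i, wmean (p i) (U i) := Finset.sum_nonneg fun i _ => (hp i).wmean_nonneg (hU0 i)
    rw [h2]
    refine (abs_add_le _ _).trans (add_le_add le_rfl ?_)
    refine (abs_sub _ _).trans ?_
    rw [abs_of_nonneg h3, abs_of_nonneg h4]
    rfl
  refine (hP.wmean_mono hpt).trans ?_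
  rw [wmean_add, wmean_add, wmean_sum_apply hp, hP.wmean_const]
  simp only [hEU]
  -- The truncated squares satisfy `T ^ 2 ≤ δ ^ 2 * X ^ 2`, so their sum has variance at most `δ ^
  -- 2`.
  have h5 : wmean (prodWeight p) (fun t => |∑ i, (T i (t i) - wmean (p i) (T i))|) ≤ δ := by
    refine (hP.wmean_abs_le_sqrt _).trans (Real.sqrt_le_iff.2 ⟨hδ, ?_⟩)
    rw [wmean_sq_sum hp (fun i x => T i x - wmean (p i) (T i)) fun i => by
      rw [wmean_sub, (hp i).wmean_const, sub_self]]
    calc ∑ i, wmean (p i) (fun x => (T i x - wmean (p i) (T i)) ^ 2)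
        ≤ ∑ i, δ ^ 2 * wmean (p i) (fun x => X i x ^ 2) := by
          refine Finset.sum_le_sum fun i _ => ((hp i).wmean_sq_sub _).trans ?_
          rw [← wmean_const_mul]
          exact (hp i).wmean_mono (hT2 i)
      _ = δ ^ 2 := by rw [← Finset.mul_sum, hv, mul_one]
  linarith

theorem wmean_sq_linear_le (hp : ∀ i, IsLaw (p i)) (hX : ∀ i, wmean (p i) (X i) = 0)
    {V : ℝ} (hV : ∀ i, wmean (p i) (fun x => X i x ^ 2) ≤ V) (e : ι → ℝ) :
    wmean (prodWeight p) (fun t => (∑ i, e i * X i (t i)) ^ 2) ≤ (∑ i, e i ^ 2) * V := by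
  rw [wmean_sq_sum hp (fun i x => e i * X i x) fun i => by rw [wmean_const_mul, hX, mul_zero],
    Finset.sum_mul]
  refine Finset.sum_le_sum fun i _ => ?_
  simp_rw [mul_pow]
  rw [wmean_const_mul]
  exact mul_le_mul_of_nonneg_left (hV i) (sq_nonneg _)

end SecondMoments

/-! ### Concentration of the residual norm -/

section StandardError

variable {B k : ℕ} {κ : Fin B → Type*} [∀ i, Fintype (κ i)] {p X : ∀ i, κ i → ℝ}
  {Q : Matrix (Fin B) (Fin k) ℝ}

/-- Exchanging the two sums brings in the column norms, bounded by twice the leverages. These add up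
to the number `k` of columns, whatever `B` is. -/
theorem wmean_residualError_le (hp : ∀ i, IsLaw (p i)) (hX : ∀ i, wmean (p i) (X i) = 0)
    {V : ℝ} (hV0 : 0 ≤ V) (hV : ∀ i, wmean (p i) (fun x => X i x ^ 2) ≤ V)
    (hQ : IsUnit (Q.transpose * Q)) (hlev : ∀ i, hat Q i i < 1) :
    wmean (prodWeight p) (fun t => ∑ l, (∑ i, residualError Q l i * X i (t i)) ^ 2)
      ≤ 2 * k * V := by
  rw [wmean_sum]
  calc _ ≤ ∑ l, (∑ i, residualError Q l i ^ 2) * V :=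
        Finset.sum_le_sum fun l _ => wmean_sq_linear_le hp hX hV _
    _ = (∑ i, ∑ l, residualError Q l i ^ 2) * V := by rw [← Finset.sum_mul, Finset.sum_comm]
    _ ≤ (∑ i, 2 * hat Q i i) * V := by
        gcongr with i
        exact sum_sq_residualError_le hQ i (hlev i)
    _ = 2 * k * V := by rw [← Finset.mul_sum, sum_hat_diag hQ]

/-- The Euclidean norm of the residuals of the leverage-adjusted vector `g`. -/
def residualNorm (Q : Matrix (Fin B) (Fin k) ℝ) (g : Fin B → ℝ) : ℝ :=
  √(∑ l, (1 - hat Q).mulVec (fun i => g i / √(1 - hat Q i i)) l ^ 2)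

/-- The bound on the probability that the standard error is off by more than `3 ε`. -/
def errorBound (k : ℕ) (δ ε L : ℝ) : ℝ :=
  (δ + 2 * L) / ε + ((δ ^ 2 + L) / ε ^ 2 + 2 * k * (δ ^ 2 + L) / ε ^ 2)

/-- Markov's inequality bounds three exceptional events: `∑ X ^ 2` far from one, a large component
of `X` along the mean residual, and a large residual error. The mean residual can only lengthen the
vector appreciably, so the upper bound requires `m = 0`. -/
theorem wprob_residualNorm_le (hp : ∀ i, IsLaw (p i)) (hX : ∀ i, wmean (p i) (X i) = 0)
    (hv : ∑ i, wmean (p i) (fun x => X i x ^ 2) = 1)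
    (hQ : IsUnit (Q.transpose * Q)) (hlev : ∀ i, hat Q i i < 1) (m : Fin B → ℝ)
    {δ ε : ℝ} (hδ : 0 ≤ δ) (hε : 0 < ε) :
    wprob (prodWeight p) (fun t =>
      ¬ (1 - 3 * ε ≤ residualNorm Q (fun i => X i (t i) + m i) ∧
        (m = 0 → residualNorm Q (fun i => X i (t i) + m i) ≤ 1 + 3 * ε)))
      ≤ errorBound k δ ε (∑ i, tailSq (p i) (X i) δ) := by
  have hP := IsLaw.prodWeight hp
  set L := ∑ i, tailSq (p i) (X i) δ with hL
  have hL0 (i) : 0 ≤ tailSq (p i) (X i) δ := (hp i).tailSq_nonneg _ _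
  have hL' : 0 ≤ L := Finset.sum_nonneg fun i _ => hL0 i
  have hV (i) : wmean (p i) (fun x => X i x ^ 2) ≤ δ ^ 2 + L :=
    ((hp i).wmean_sq_le_tailSq (X i) δ).trans
      (add_le_add le_rfl (Finset.single_le_sum (fun i _ => hL0 i) (Finset.mem_univ i)))
  have hV0 : 0 ≤ δ ^ 2 + L := by positivity
  set q := (1 - hat Q).mulVec (fun i => m i / √(1 - hat Q i i)) with hq
  obtain ⟨e, he1, he⟩ := exists_unit_direction q
  let A (t : ∀ i, κ i) : Prop := ε < |∑ i, X i (t i) ^ 2 - 1|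
  let C (t : ∀ i, κ i) : Prop := ε ^ 2 < (∑ i, e i * X i (t i)) ^ 2
  let E (t : ∀ i, κ i) : Prop := ε ^ 2 < ∑ l, (∑ i, residualError Q l i * X i (t i)) ^ 2
  have hA : wprob (prodWeight p) A ≤ (δ + 2 * L) / ε :=
    (hP.wprob_le_div (fun t => abs_nonneg _) hε).trans
      (by gcongr; exact wmean_abs_sum_sq_sub_one_le hp hv hδ)
  have hC : wprob (prodWeight p) C ≤ (δ ^ 2 + L) / ε ^ 2 :=
    (hP.wprob_le_div (fun t => sq_nonneg _) (by positivity)).trans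
      (by
        gcongr
        exact (wmean_sq_linear_le hp hX hV e).trans (mul_le_of_le_one_left hV0 he1))
  have hE : wprob (prodWeight p) E ≤ 2 * k * (δ ^ 2 + L) / ε ^ 2 :=
    (hP.wprob_le_div (fun t => Finset.sum_nonneg fun l _ => sq_nonneg _) (by positivity)).trans
      (by gcongr; exact wmean_residualError_le hp hX hV0 hV hQ hlev)
  have hsub (t) (ht : ¬ (1 - 3 * ε ≤ residualNorm Q (fun i => X i (t i) + m i) ∧
      (m = 0 → residualNorm Q (fun i => X i (t i) + m i) ≤ 1 + 3 * ε))) : A t ∨ C t ∨ E t := by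
    by_contra hn
    simp only [A, C, E, not_or, not_lt] at hn
    obtain ⟨h1, h2, h3⟩ := hn
    refine ht ⟨?_, fun hm => ?_⟩
    · unfold residualNorm
      simp only [residual_eq Q (fun i => X i (t i)) m]
      exact sqrt_sum_sq_lower hε he h1 h2 h3
    · unfold residualNorm
      simp only [residual_eq Q (fun i => X i (t i)) m]
      have hq0 : q = 0 := by
        rw [hq, hm]
        simp [← Pi.zero_def]
      simp only [← hq, hq0, Pi.zero_apply, add_zero]
      exact sqrt_sum_sq_upper hε h1 h3
  calc _ ≤ wprob (prodWeight p) (fun t => A t ∨ C t ∨ E t) := hP.wprob_mono hsub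
    _ ≤ wprob (prodWeight p) A + (wprob (prodWeight p) C + wprob (prodWeight p) E) :=
      (hP.wprob_or_le _ _).trans (add_le_add le_rfl (hP.wprob_or_le _ _))
    _ ≤ _ := add_le_add hA (add_le_add hC hE)

end StandardError

/-! ### The standard normal quantile -/

section NormalQuantile

open MeasureTheory ProbabilityTheory

/-- A distribution function is right continuous, and its jump from the left is the mass of a point,
here zero. -/
theorem continuous_cdf_gaussianReal : Continuous fun x => cdf (gaussianReal 0 1) x := by
  have := nullSingletonClass_gaussianReal (μ := 0) (v := 1) one_ne_zero
  refine continuous_iff_continuousAt.2 fun x => ?_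
  rw [continuousAt_iff_continuous_left'_right']
  refine ⟨?_, ((cdf (gaussianReal 0 1)).right_continuous x).mono Set.Ioi_subset_Ici_self⟩
  rw [(monotone_cdf _).continuousWithinAt_Iio_iff_leftLim_eq]
  have h := (cdf (gaussianReal 0 1)).measure_singleton x
  rw [measure_cdf, measure_singleton, eq_comm, ENNReal.ofReal_eq_zero, sub_nonpos] at h
  exact le_antisymm ((monotone_cdf _).leftLim_le le_rfl) h

theorem cdf_gaussianReal_zero : cdf (gaussianReal 0 1) 0 = 1 / 2 := by
  have := nullSingletonClass_gaussianReal (μ := 0) (v := 1) one_ne_zero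
  have h1 : (gaussianReal 0 1).map (fun x => -x) = gaussianReal 0 1 := by
    rw [gaussianReal_map_neg, neg_zero]
  have h2 : (gaussianReal 0 1).real (Set.Iic 0) = (gaussianReal 0 1).real (Set.Ici 0) := by
    conv_lhs => rw [← h1]
    rw [map_measureReal_apply (by fun_prop) measurableSet_Iic]
    congr 1
    ext x
    simp
  have h3 : (gaussianReal 0 1).real (Set.Ici 0) = 1 - (gaussianReal 0 1).real (Set.Iic 0) := by
    rw [← probReal_compl_eq_one_sub measurableSet_Iic, Set.compl_Iic]
    exact measureReal_congr Ioi_ae_eq_Ici.symm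
  rw [cdf_eq_real]
  linarith

theorem cdf_gaussianReal_lt_half {x : ℝ} (hx : x < 0) : cdf (gaussianReal 0 1) x < 1 / 2 := by
  rw [← cdf_gaussianReal_zero, cdf_eq_real, cdf_eq_real]
  have hpos : 0 < (gaussianReal 0 1).real (Set.Ioc x 0) := by
    rw [measureReal_def, ENNReal.toReal_pos_iff]
    refine ⟨?_, measure_lt_top _ _⟩
    rw [pos_iff_ne_zero]
    intro h
    have := gaussianReal_absolutelyContinuous' 0 (one_ne_zero (α := NNReal)) h
    rw [Real.volume_Ioc, ENNReal.ofReal_eq_zero] at this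
    linarith
  rw [← Set.Iic_union_Ioc_eq_Iic hx.le, measureReal_union (Set.Iic_disjoint_Ioc le_rfl)
    measurableSet_Ioc]
  linarith

variable {q : ℝ}

/-- By continuity the set in the infimum is closed, so the infimum belongs to it. Were the value
above `q`, points slightly to the left would belong to it too. Boundedness below comes from `1 / 2 ≤
q`. -/
theorem cdf_normalQuantile (h0 : 1 / 2 ≤ q) (h1 : q < 1) :
    cdf (gaussianReal 0 1) (normalQuantile q) = q := by
  have hne : {x : ℝ | q ≤ cdf (gaussianReal 0 1) x}.Nonempty := by
    obtain ⟨x, hx⟩ := ((tendsto_cdf_atTop (gaussianReal 0 1)).eventually_const_lt h1).exists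
    exact ⟨x, hx.le⟩
  have hbdd : BddBelow {x : ℝ | q ≤ cdf (gaussianReal 0 1) x} := by
    refine ⟨0, fun x hx => ?_⟩
    by_contra hn
    have := cdf_gaussianReal_lt_half (not_le.1 hn)
    have : q ≤ _ := hx
    linarith
  have hcl : IsClosed {x : ℝ | q ≤ cdf (gaussianReal 0 1) x} :=
    isClosed_le continuous_const continuous_cdf_gaussianReal
  have hmem : q ≤ cdf (gaussianReal 0 1) (normalQuantile q) := hcl.csInf_mem hne hbdd
  refine le_antisymm (not_lt.1 fun hlt => ?_) hmem
  have hev : ∀ᶠ x in 𝓝[<] (normalQuantile q), q < cdf (gaussianReal 0 1) x :=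
    (continuous_cdf_gaussianReal.continuousAt.eventually_const_lt hlt).filter_mono
      nhdsWithin_le_nhds
  obtain ⟨x, hx, hx'⟩ := (hev.and self_mem_nhdsWithin).exists
  exact absurd (csInf_le hbdd (show x ∈ {x : ℝ | q ≤ cdf (gaussianReal 0 1) x} from hx.le))
    (not_le.2 hx')

theorem normalQuantile_nonneg (h0 : 1 / 2 ≤ q) : 0 ≤ normalQuantile q := by
  refine Real.sInf_nonneg fun x hx => ?_
  by_contra hn
  have := cdf_gaussianReal_lt_half (not_le.1 hn)
  have : q ≤ _ := hx
  linarith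

end NormalQuantile

/-! ### Limits of the studentized sum -/

section Studentized

open ProbabilityTheory

variable {k : ℕ} {n : ∀ B : ℕ, Fin B → ℕ} {p X : ∀ B i, Fin (n B i) → ℝ}
  {Q : ∀ B : ℕ, Matrix (Fin B) (Fin k) ℝ} {m : ∀ B : ℕ, Fin B → ℝ} {c : ℝ}

/-- The probability that the standard error is off by more than `3 ε`. -/
def badProb (p X : ∀ B i, Fin (n B i) → ℝ) (Q : ∀ B : ℕ, Matrix (Fin B) (Fin k) ℝ)
    (m : ∀ B : ℕ, Fin B → ℝ) (ε : ℝ) (B : ℕ) : ℝ :=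
  wprob (prodWeight (p B)) fun t =>
    ¬ (1 - 3 * ε ≤ residualNorm (Q B) (fun i => X B i (t i) + m B i) ∧
      (m B = 0 → residualNorm (Q B) (fun i => X B i (t i) + m B i) ≤ 1 + 3 * ε))

theorem IsLindebergArray.tendsto_badProb (h : IsLindebergArray p X)
    (hQ : ∀ B, k < B → IsUnit ((Q B).transpose * Q B))
    (hlev : ∀ B, k < B → ∀ i, hat (Q B) i i < 1) (m : ∀ B : ℕ, Fin B → ℝ) {ε : ℝ} (hε : 0 < ε) :
    Tendsto (badProb p X Q m ε) atTop (𝓝 0) := by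
  refine Metric.tendsto_nhds.2 fun ε' hε' => ?_
  have h0 : Tendsto (fun δ : ℝ => errorBound k δ ε 0) (𝓝[>] 0) (𝓝 0) := by
    have : ContinuousAt (fun δ : ℝ => errorBound k δ ε 0) 0 := by
      unfold errorBound
      fun_prop
    have e : errorBound k 0 ε 0 = 0 := by simp [errorBound]
    have := this.tendsto
    rw [e] at this
    exact this.mono_left nhdsWithin_le_nhds
  obtain ⟨δ, hδε, hδ⟩ := ((h0.eventually_lt_const hε').and self_mem_nhdsWithin).exists
  have h1 : Tendsto (fun B => errorBound k δ ε (∑ i, tailSq (p B i) (X B i) δ)) atTop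
      (𝓝 (errorBound k δ ε 0)) := by
    have : Continuous (errorBound k δ ε) := by
      unfold errorBound
      fun_prop
    exact (this.tendsto 0).comp (h.lindeberg δ hδ)
  filter_upwards [h1.eventually_lt_const hδε, h.variance, eventually_gt_atTop k] with B hB hv hk
  rw [Real.dist_0_eq_abs, badProb, abs_of_nonneg ((IsLaw.prodWeight (h.law B)).wprob_nonneg _)]
  exact (wprob_residualNorm_le (h.law B) (h.centred B) hv (hQ B hk) (hlev B hk) (m B)
    (le_of_lt hδ) hε).trans_lt hB

/-- The rejection probability of the studentized sum. -/
def rejectProb (p X : ∀ B i, Fin (n B i) → ℝ) (Q : ∀ B : ℕ, Matrix (Fin B) (Fin k) ℝ)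
    (m : ∀ B : ℕ, Fin B → ℝ) (c : ℝ) (B : ℕ) : ℝ :=
  wprob (prodWeight (p B)) fun t =>
    c ≤ (∑ i, (X B i (t i) + m B i)) / residualNorm (Q B) (fun i => X B i (t i) + m B i)

theorem tendsto_normalTail (c : ℝ) {f : ℝ → ℝ} (hf : Continuous f) (h0 : f 0 = c) :
    Tendsto (fun ε => 1 - cdf (gaussianReal 0 1) (f ε)) (𝓝[>] 0)
      (𝓝 (1 - cdf (gaussianReal 0 1) c)) := by
  have : Continuous fun ε => 1 - cdf (gaussianReal 0 1) (f ε) :=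
    continuous_const.sub (continuous_cdf_gaussianReal.comp hf)
  have := this.tendsto 0
  rw [h0] at this
  exact this.mono_left nhdsWithin_le_nhds

/-- Off the bad event the denominator is at least `1 - 3 * ε > 0`. As `0 ≤ c`, rejection then forces
the centred sum to reach `c * (1 - 3 * ε) - ε`. Only upper control of the mean is needed. -/
theorem IsLindebergArray.eventually_rejectProb_lt (h : IsLindebergArray p X)
    (hQ : ∀ B, k < B → IsUnit ((Q B).transpose * Q B))
    (hlev : ∀ B, k < B → ∀ i, hat (Q B) i i < 1) (hc : 0 ≤ c)
    (hm : ∀ ε > 0, ∀ᶠ B in atTop, ∑ i, m B i ≤ ε) {b : ℝ}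
    (hb : 1 - cdf (gaussianReal 0 1) c < b) :
    ∀ᶠ B in atTop, rejectProb p X Q m c B < b := by
  have h1 := tendsto_normalTail c (f := fun ε => c * (1 - 3 * ε) - ε) (by fun_prop) (by simp)
  have h3 : ∀ᶠ ε : ℝ in 𝓝[>] 0, ε < 1 / 3 :=
    nhdsWithin_le_nhds (eventually_lt_nhds (by norm_num))
  obtain ⟨ε, ⟨hεb, hε3⟩, hε⟩ :=
    (((h1.eventually_lt_const hb).and h3).and self_mem_nhdsWithin).exists
  replace hε : 0 < ε := hε
  have h2 := (h.tendsto_badProb hQ hlev m hε).add (h.tendsto_wprob (c * (1 - 3 * ε) - ε))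
  rw [zero_add] at h2
  filter_upwards [h2.eventually_lt_const hεb, hm ε hε] with B hB hmB
  refine lt_of_le_of_lt ?_ hB
  have hP := IsLaw.prodWeight (h.law B)
  refine le_trans (hP.wprob_mono fun t ht => ?_) (hP.wprob_or_le _ _)
  by_contra hn
  obtain ⟨hn1, hn2⟩ := not_or.1 hn
  rw [not_not] at hn1
  refine hn2 ?_
  have hpos : 0 < residualNorm (Q B) (fun i => X B i (t i) + m B i) :=
    lt_of_lt_of_le (by linarith) hn1.1
  rw [le_div_iff₀ hpos, Finset.sum_add_distrib] at ht
  have := mul_le_mul_of_nonneg_left hn1.1 hc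
  linarith

theorem IsLindebergArray.tendsto_rejectProb (h : IsLindebergArray p X)
    (hQ : ∀ B, k < B → IsUnit ((Q B).transpose * Q B))
    (hlev : ∀ B, k < B → ∀ i, hat (Q B) i i < 1) (hc : 0 ≤ c) (hm : ∀ B, m B = 0) :
    Tendsto (rejectProb p X Q m c) atTop (𝓝 (1 - cdf (gaussianReal 0 1) c)) := by
  refine tendsto_order.2 ⟨fun b hb => ?_, fun b hb =>
    h.eventually_rejectProb_lt hQ hlev hc (fun ε hε => ?_) hb⟩
  · have h1 := tendsto_normalTail c (f := fun ε => c * (1 + 3 * ε)) (by fun_prop) (by simp)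
    have h3 : ∀ᶠ ε : ℝ in 𝓝[>] 0, ε < 1 / 3 :=
      nhdsWithin_le_nhds (eventually_lt_nhds (by norm_num))
    obtain ⟨ε, ⟨hεb, hε3⟩, hε⟩ :=
      (((h1.eventually_const_lt hb).and h3).and self_mem_nhdsWithin).exists
    replace hε : 0 < ε := hε
    have h2 := (h.tendsto_wprob (c * (1 + 3 * ε))).sub (h.tendsto_badProb hQ hlev m hε)
    rw [sub_zero] at h2
    filter_upwards [h2.eventually_const_lt hεb] with B hB
    refine hB.trans_le ?_
    have hP := IsLaw.prodWeight (h.law B)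
    rw [sub_le_iff_le_add]
    refine le_trans (hP.wprob_mono fun t ht => ?_) (hP.wprob_or_le _ _)
    by_contra hn
    obtain ⟨hn1, hn2⟩ := not_or.1 hn
    rw [not_not] at hn2
    refine hn1 ?_
    have hpos : 0 < residualNorm (Q B) (fun i => X B i (t i) + m B i) :=
      lt_of_lt_of_le (by linarith) hn2.1
    rw [le_div_iff₀ hpos, Finset.sum_add_distrib, hm B]
    have := mul_le_mul_of_nonneg_left (hn2.2 (hm B)) hc
    rw [hm B] at this
    simp only [Pi.zero_apply, Finset.sum_const_zero, add_zero] at this ⊢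
    linarith
  · filter_upwards with B
    rw [hm B]
    simpa using hε.le

end Studentized

/-! ### Conditional assignment laws as product laws -/

section Assignments

variable {B : ℕ} {n : Fin B → ℕ}

/-- The treatment vector in which `t i` is the treated individual of set `i`. -/
def assign (t : ∀ i, Fin (n i)) : Treatment n := fun i j => decide (j = t i)

theorem assign_mem_Omega (t : ∀ i, Fin (n i)) : assign t ∈ Omega n := by
  simp [Omega, assign, Finset.filter_eq']

theorem exists_assign_eq {z : Treatment n} (hz : z ∈ Omega n) : ∃ t, assign t = z := by
  simp only [Omega, Finset.mem_filter, Finset.mem_univ, true_and, Finset.card_eq_one] at hz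
  choose t ht using hz
  refine ⟨t, funext fun i => funext fun j => ?_⟩
  have := Finset.ext_iff.1 (ht i) j
  simp only [Finset.mem_filter, Finset.mem_univ, true_and, Finset.mem_singleton] at this
  rw [assign, Bool.eq_iff_iff, decide_eq_true_eq, this]

theorem assign_injective : Function.Injective (assign (n := n)) := by
  intro t s h
  funext i
  have := congrFun (congrFun h i) (t i)
  simpa [assign] using this

theorem sum_Omega (g : Treatment n → ℝ) : ∑ z ∈ Omega n, g z = ∑ t, g (assign t) := by
  refine (Finset.sum_nbij assign (fun t _ => assign_mem_Omega t) assign_injective.injOn ?_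
    fun _ _ => rfl).symm
  intro z hz
  obtain ⟨t, ht⟩ := exists_assign_eq hz
  exact ⟨t, by simp, ht⟩

theorem condProb_congr {w w' : Treatment n → ℝ} {C : ℝ} (hC : C ≠ 0)
    (h : ∀ t, w (assign t) = C * w' (assign t)) {z : Treatment n} (hz : z ∈ Omega n) :
    condProb w z = condProb w' z := by
  obtain ⟨t, rfl⟩ := exists_assign_eq hz
  rw [condProb, condProb, sum_Omega, sum_Omega, h]
  simp_rw [h, ← Finset.mul_sum]
  rw [mul_div_mul_left _ _ hC]

theorem condMean_congr {w w' : Treatment n → ℝ}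
    (h : ∀ z ∈ Omega n, condProb w z = condProb w' z) (f : Treatment n → ℝ) :
    condMean w f = condMean w' f :=
  Finset.sum_congr rfl fun z hz => by rw [h z hz]

/-- Given `Omega n`, the treated individuals of the sets are independent with laws `p i`. -/
structure HasIndepLaw (w : Treatment n → ℝ) (p : ∀ i, Fin (n i) → ℝ) : Prop where
  law : ∀ i, IsLaw (p i)
  condMean_eq : ∀ f, condMean w f = wmean (prodWeight p) fun t => f (assign t)

theorem sum_ind_assign (t : ∀ i, Fin (n i)) (u : ∀ i, Fin (n i) → ℝ) (i : Fin B) :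
    ∑ j, ind (assign t i j) * u i j = u i (t i) := by
  simp [ind, assign]

/-- The law, in each set, of the treated individual under the hidden bias `u`. -/
def biasLaw (Γ : ℝ) (u : ∀ i, Fin (n i) → ℝ) (i : Fin B) (j : Fin (n i)) : ℝ :=
  Real.exp (Real.log Γ * u i j) / ∑ k, Real.exp (Real.log Γ * u i k)

theorem biasWeight_assign (Γ : ℝ) (u : ∀ i, Fin (n i) → ℝ) (t : ∀ i, Fin (n i)) :
    biasWeight Γ u (assign t) = ∏ i, Real.exp (Real.log Γ * u i (t i)) := by
  simp_rw [biasWeight, sum_ind_assign]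
  rw [Finset.mul_sum, Real.exp_sum]

variable (hn : ∀ i, 2 ≤ n i)
include hn

theorem sum_exp_pos (Γ : ℝ) (u : ∀ i, Fin (n i) → ℝ) (i : Fin B) :
    0 < ∑ k, Real.exp (Real.log Γ * u i k) :=
  Finset.sum_pos (fun k _ => Real.exp_pos _) ⟨⟨0, by have := hn i; omega⟩, Finset.mem_univ _⟩

theorem isLaw_biasLaw (Γ : ℝ) (u : ∀ i, Fin (n i) → ℝ) (i : Fin B) : IsLaw (biasLaw Γ u i) where
  nonneg j := div_nonneg (Real.exp_pos _).le (sum_exp_pos hn Γ u i).le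
  sum_eq_one := by
    simp_rw [biasLaw, ← Finset.sum_div]
    exact div_self (sum_exp_pos hn Γ u i).ne'

/-- Both the exponential weight and its normalizing sum factor over the sets. -/
theorem hasIndepLaw_biasWeight (Γ : ℝ) (u : ∀ i, Fin (n i) → ℝ) :
    HasIndepLaw (biasWeight Γ u) (biasLaw Γ u) where
  law := isLaw_biasLaw hn Γ u
  condMean_eq f := by
    rw [condMean, sum_Omega]
    refine Finset.sum_congr rfl fun t _ => ?_
    congr 1
    rw [condProb, sum_Omega]
    simp_rw [biasWeight_assign, prodWeight, biasLaw, Finset.prod_div_distrib]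
    rw [sum_prod_apply (fun i j => Real.exp (Real.log Γ * u i j))]

theorem biasLaw_le_mul {Γ : ℝ} (hΓ : 1 ≤ Γ) {u : ∀ i, Fin (n i) → ℝ} (hu : u ∈ unitCube n)
    (i : Fin B) (j k : Fin (n i)) : biasLaw Γ u i j ≤ Γ * biasLaw Γ u i k := by
  rw [biasLaw, biasLaw, ← mul_div_assoc]
  refine div_le_div_of_nonneg_right ?_ (sum_exp_pos hn Γ u i).le
  have hl := Real.log_nonneg hΓ
  conv_rhs => rw [← Real.exp_log (show 0 < Γ by linarith), Real.log_exp, ← Real.exp_add]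
  refine Real.exp_le_exp.2 ?_
  nlinarith [(hu i j).2, (hu i k).1]

omit hn in
-- Only the odds of the treated individuals depend on `t`; the prefactor disappears on conditioning.
theorem assignWeight_assign {prob : ∀ i, Fin (n i) → ℝ} (hp : ∀ i j, 0 < prob i j ∧ prob i j < 1)
    (t : ∀ i, Fin (n i)) :
    assignWeight prob (assign t)
      = (∏ i, ∏ j, (1 - prob i j)) * ∏ i, prob i (t i) / (1 - prob i (t i)) := by
  rw [assignWeight, ← Finset.prod_mul_distrib]
  refine Finset.prod_congr rfl fun i _ => ?_
  have h1 : 1 - prob i (t i) ≠ 0 := by linarith [(hp i (t i)).2]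
  rw [← Finset.mul_prod_erase _ _ (Finset.mem_univ (t i)),
    ← Finset.mul_prod_erase _ (fun j => 1 - prob i j) (Finset.mem_univ (t i))]
  have h2 : ∏ j ∈ Finset.univ.erase (t i), (if assign t i j = true then prob i j else 1 - prob i j)
      = ∏ j ∈ Finset.univ.erase (t i), (1 - prob i j) := by
    refine Finset.prod_congr rfl fun j hj => ?_
    simp [assign, Finset.ne_of_mem_erase hj]
  rw [h2]
  simp only [assign, decide_true, if_true]
  field_simp

/-- If the odds are proportional, within each set, to the exponential weights of `u`, then the
conditional assignment law is the one of the hidden bias `u`. -/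
theorem condProb_eq_of_odds {Γ : ℝ} {prob u : ∀ i, Fin (n i) → ℝ} {c : Fin B → ℝ}
    (hp : ∀ i j, 0 < prob i j ∧ prob i j < 1)
    (h : ∀ i j, prob i j / (1 - prob i j) = c i * Real.exp (Real.log Γ * u i j))
    {z : Treatment n} (hz : z ∈ Omega n) :
    condProb (assignWeight prob) z = condProb (biasWeight Γ u) z := by
  refine condProb_congr (C := (∏ i, ∏ j, (1 - prob i j)) * ∏ i, c i) ?_ (fun t => ?_) hz
  · refine mul_ne_zero (Finset.prod_ne_zero_iff.2 fun i _ => Finset.prod_ne_zero_iff.2 fun j _ => ?_)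
      (Finset.prod_ne_zero_iff.2 fun i _ hc => ?_)
    · linarith [(hp i j).2]
    · have hj := h i ⟨0, by have := hn i; omega⟩
      rw [hc, zero_mul] at hj
      exact (div_pos (hp i _).1 (by linarith [(hp i ⟨0, by have := hn i; omega⟩).2])).ne' hj
  · rw [assignWeight_assign hp, biasWeight_assign]
    simp_rw [h, Finset.prod_mul_distrib]
    ring

/-- The smallest odds of each set serve as baseline. The log odds ratios to it lie between 0 and
`log Γ`, and dividing by `log Γ` puts them in the unit interval. -/
theorem SensModel.exists_bias {Γ : ℝ} {prob : ∀ i, Fin (n i) → ℝ} (h : SensModel Γ prob) :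
    ∃ u ∈ unitCube n, ∀ z ∈ Omega n,
      condProb (assignWeight prob) z = condProb (biasWeight Γ u) z := by
  obtain ⟨hp, hr⟩ := h
  set o : ∀ i, Fin (n i) → ℝ := fun i j => prob i j / (1 - prob i j) with ho
  have ho0 (i j) : 0 < o i j := div_pos (hp i j).1 (by linarith [(hp i j).2])
  have hmin (i) : ∃ k, ∀ j, o i k ≤ o i j := by
    have : Nonempty (Fin (n i)) := ⟨⟨0, by have := hn i; omega⟩⟩
    exact Finite.exists_min (o i)
  choose k hk using hmin
  have hratio (i j) : o i j / o i (k i) ≤ Γ := by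
    refine le_of_eq_of_le ?_ (hr i j (k i)).2
    have h1 : 1 - prob i j ≠ 0 := by linarith [(hp i j).2]
    have h2 : 1 - prob i (k i) ≠ 0 := by linarith [(hp i (k i)).2]
    have h3 := (hp i (k i)).1.ne'
    simp only [ho]
    field_simp
  have hlog0 (i j) : 0 ≤ Real.log (o i j / o i (k i)) :=
    Real.log_nonneg ((one_le_div (ho0 i _)).2 (hk i j))
  have hlog1 (i j) : Real.log (o i j / o i (k i)) ≤ Real.log Γ :=
    Real.log_le_log (div_pos (ho0 i j) (ho0 i _)) (hratio i j)
  refine ⟨fun i j => Real.log (o i j / o i (k i)) / Real.log Γ, fun i j => ⟨?_, ?_⟩, fun z hz => ?_⟩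
  · exact div_nonneg (hlog0 i j) ((hlog0 i j).trans (hlog1 i j))
  · exact div_le_one_of_le₀ (hlog1 i j) ((hlog0 i j).trans (hlog1 i j))
  · refine condProb_eq_of_odds hn (c := fun i => o i (k i)) hp (fun i j => ?_) hz
    -- If `log Γ = 0`, the quotient is zero by convention, and all log ratios vanish as well.
    have e : Real.log Γ * (Real.log (o i j / o i (k i)) / Real.log Γ)
        = Real.log (o i j / o i (k i)) := by
      rcases eq_or_ne (Real.log Γ) 0 with h0 | h0
      · have := hlog0 i j
        have := hlog1 i j
        rw [h0, zero_mul]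
        linarith
      · field_simp
    rw [e, Real.exp_log (div_pos (ho0 i j) (ho0 i _)), mul_div_cancel₀ _ (ho0 i _).ne']

end Assignments

/-! ### The concave function behind the statistic -/

section Tilt

/-- The function `x - (Γ - 1) / (1 + Γ) |x|`. -/
def tilt (Γ x : ℝ) : ℝ := x - ((Γ - 1) / (1 + Γ)) * |x|

variable {Γ : ℝ} (hΓ : 1 ≤ Γ)

theorem tilt_mul (Γ : ℝ) {s : ℝ} (hs : 0 ≤ s) (x : ℝ) : tilt Γ (s * x) = s * tilt Γ x := by
  rw [tilt, tilt, abs_mul, abs_of_nonneg hs]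
  ring

include hΓ

theorem tilt_of_nonneg {x : ℝ} (hx : 0 ≤ x) : tilt Γ x = 2 / (1 + Γ) * x := by
  rw [tilt, abs_of_nonneg hx]
  field_simp
  ring

theorem tilt_of_nonpos {x : ℝ} (hx : x ≤ 0) : tilt Γ x = 2 / (1 + Γ) * (Γ * x) := by
  rw [tilt, abs_of_nonpos hx]
  field_simp
  ring

/-- `tilt` is the minimum of two lines through the origin. The right side extends the line active at
`y`, which lies above the graph everywhere. -/
theorem tilt_add_le (y a : ℝ) :
    tilt Γ (y + a) ≤ tilt Γ y
      + (a * (1 + (Γ - 1) / (1 + Γ)) - 2 * ((Γ - 1) / (1 + Γ)) * a * if 0 ≤ y then 1 else 0) := by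
  have hκ : 0 ≤ (Γ - 1) / (1 + Γ) := div_nonneg (by linarith) (by linarith)
  rw [tilt, tilt]
  generalize (Γ - 1) / (1 + Γ) = κ at hκ
  split_ifs with h
  · rw [abs_of_nonneg h]
    nlinarith [mul_le_mul_of_nonneg_left (le_abs_self (y + a)) hκ]
  · rw [abs_of_neg (not_le.1 h)]
    nlinarith [mul_le_mul_of_nonneg_left (neg_le_abs (y + a)) hκ]

theorem abs_tilt_le (x : ℝ) : |tilt Γ x| ≤ 2 * |x| := by
  have h0 : 0 ≤ (Γ - 1) / (1 + Γ) := div_nonneg (by linarith) (by linarith)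
  have h1 : (Γ - 1) / (1 + Γ) ≤ 1 := (div_le_one (by linarith)).2 (by linarith)
  rw [tilt]
  refine (abs_sub _ _).trans ?_
  rw [abs_mul, abs_abs, abs_of_nonneg h0]
  nlinarith [abs_nonneg x]

theorem le_abs_tilt (x : ℝ) : 2 / (1 + Γ) * |x| ≤ |tilt Γ x| := by
  have h2 : 0 ≤ 2 / (1 + Γ) := div_nonneg (by norm_num) (by linarith)
  rcases le_total 0 x with h | h
  · rw [tilt_of_nonneg hΓ h, abs_mul, abs_of_nonneg h2]
  · rw [tilt_of_nonpos hΓ h, abs_mul, abs_of_nonneg h2, abs_mul]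
    refine mul_le_mul_of_nonneg_left ?_ h2
    exact le_mul_of_one_le_left (abs_nonneg x) (hΓ.trans (le_abs_self Γ))

variable {Ω : Type*} [Fintype Ω] {q y : Ω → ℝ}

/-- Let `q k` be the largest weight. Each term is at most `2 / (1 + Γ) * q k * y j`: for `y j ≥ 0`
because `q j ≤ q k`, for `y j ≤ 0` because `q k ≤ Γ * q j`. These bounds sum to zero. -/
theorem wmean_tilt_nonpos (hq : ∀ j k, q j ≤ Γ * q k) (hy : ∑ j, y j = 0) :
    wmean q (fun j => tilt Γ (y j)) ≤ 0 := by
  rcases isEmpty_or_nonempty Ω with h | h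
  · simp [wmean]
  obtain ⟨k, hk⟩ := Finite.exists_max q
  have h2 : 0 ≤ 2 / (1 + Γ) := div_nonneg (by norm_num) (by linarith)
  have hpt (j) : q j * tilt Γ (y j) ≤ 2 / (1 + Γ) * q k * y j := by
    rcases le_total 0 (y j) with hj | hj
    · rw [tilt_of_nonneg hΓ hj]
      nlinarith [mul_le_mul_of_nonneg_right (hk j) (mul_nonneg h2 hj)]
    · rw [tilt_of_nonpos hΓ hj]
      nlinarith [mul_le_mul_of_nonneg_right (hq k j) (mul_nonneg h2 (neg_nonneg.2 hj))]
  refine (Finset.sum_le_sum fun j _ => hpt j).trans_eq ?_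
  rw [← Finset.mul_sum, hy, mul_zero]

/-- The weight ratio exactly undoes the ratio of the two slopes, leaving a multiple of `∑ y j`. -/
theorem wmean_tilt_eq_zero {c : ℝ} (hq : ∀ j, q j = c * if 0 ≤ y j then Γ else 1)
    (hy : ∑ j, y j = 0) : wmean q (fun j => tilt Γ (y j)) = 0 := by
  have hpt (j) : q j * tilt Γ (y j) = 2 / (1 + Γ) * c * Γ * y j := by
    rw [hq]
    split_ifs with hj
    · rw [tilt_of_nonneg hΓ hj]
      ring
    · rw [tilt_of_nonpos hΓ (not_le.1 hj).le]
      ring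
  rw [wmean, Finset.sum_congr rfl fun j _ => hpt j, ← Finset.mul_sum, hy, mul_zero]

end Tilt

/-! ### Exact moments and the bias bound in one study -/

section FiniteSample

variable {B : ℕ} {n : Fin B → ℕ} (r : Outcomes n)

theorem Outcomes.tauHat_assign (t : ∀ i, Fin (n i)) (i : Fin B) :
    r.tauHat (assign t) i = r.diffIf i (t i) := by
  rw [tauHat, ← Finset.add_sum_erase _ _ (Finset.mem_univ (t i)), diffIf, Finset.sum_div,
    sub_eq_add_neg (r.rT i (t i)), ← Finset.sum_neg_distrib]
  congr 1
  · simp [observed, assign, ind]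
  · refine Finset.sum_congr rfl fun j hj => ?_
    simp [observed, assign, ind, Finset.ne_of_mem_erase hj]

theorem Outcomes.D_assign (Γ τ₀ : ℝ) (t : ∀ i, Fin (n i)) (i : Fin B) :
    r.D Γ τ₀ (assign t) i = tilt Γ (r.diffIf i (t i) - τ₀) := by
  rw [D, tauHat_assign, tilt]

theorem Outcomes.Dbar_assign (Γ τ₀ : ℝ) (t : ∀ i, Fin (n i)) :
    r.Dbar Γ τ₀ (assign t) = ∑ i, (n i : ℝ) / total n * tilt Γ (r.diffIf i (t i) - τ₀) := by
  simp_rw [Dbar, D_assign]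

variable {r} {w : Treatment n → ℝ} {p : ∀ i, Fin (n i) → ℝ}

theorem HasIndepLaw.condMean_apply (h : HasIndepLaw w p) {f : Treatment n → ℝ} {i : Fin B}
    {g : Fin (n i) → ℝ} (hfg : ∀ t, f (assign t) = g (t i)) : condMean w f = wmean (p i) g := by
  rw [h.condMean_eq]
  simp only [hfg]
  -- `g` lives on the single fibre `i`; it is extended by zero to a family over all sets.
  have := wmean_prodWeight_apply h.law (fun k x => if e : k = i then g (e ▸ x) else 0) i
  simpa using this

theorem HasIndepLaw.condMean_D (h : HasIndepLaw w p) (Γ τ₀ : ℝ) (i : Fin B) :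
    condMean w (fun z => r.D Γ τ₀ z i) = wmean (p i) (fun j => tilt Γ (r.diffIf i j - τ₀)) :=
  h.condMean_apply fun t => r.D_assign Γ τ₀ t i

theorem HasIndepLaw.exceedProb (h : HasIndepLaw w p) (i : Fin B) :
    exceedProb r w i = wmean (p i) (fun j => if r.setEffect i ≤ r.diffIf i j then 1 else 0) :=
  h.condMean_apply fun t => by rw [r.tauHat_assign]

theorem HasIndepLaw.condMean_Dbar (h : HasIndepLaw w p) (Γ τ₀ : ℝ) :
    condMean w (r.Dbar Γ τ₀)
      = ∑ i, (n i : ℝ) / total n * wmean (p i) (fun j => tilt Γ (r.diffIf i j - τ₀)) := by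
  rw [h.condMean_eq]
  simp_rw [r.Dbar_assign, ← wmean_const_mul]
  exact wmean_sum_apply h.law fun i j => (n i : ℝ) / total n * tilt Γ (r.diffIf i j - τ₀)

theorem HasIndepLaw.condVar_Dbar (h : HasIndepLaw w p) (Γ τ₀ : ℝ) :
    condVar w (r.Dbar Γ τ₀) = ∑ i, wmean (p i) (fun j =>
      ((n i : ℝ) / total n * tilt Γ (r.diffIf i j - τ₀)
        - (n i : ℝ) / total n * wmean (p i) (fun j => tilt Γ (r.diffIf i j - τ₀))) ^ 2) := by
  rw [condVar, h.condMean_Dbar, h.condMean_eq, ← wmean_sq_sum h.law (fun i j =>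
      (n i : ℝ) / total n * tilt Γ (r.diffIf i j - τ₀)
        - (n i : ℝ) / total n * wmean (p i) (fun j => tilt Γ (r.diffIf i j - τ₀)))]
  · simp_rw [r.Dbar_assign, Finset.sum_sub_distrib]
  · intro i
    rw [wmean_sub, (h.law i).wmean_const, wmean_const_mul, sub_self]

variable (hn : ∀ i, 2 ≤ n i)
include hn

theorem two_mul_le_total : 2 * (B : ℝ) ≤ total n := by
  have : ∑ _i : Fin B, (2 : ℝ) ≤ total n :=
    Finset.sum_le_sum fun i _ => by exact_mod_cast hn i
  simpa [mul_comm] using this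

theorem sum_effect (i : Fin B) : ∑ j, r.effect i j = n i * r.setEffect i := by
  have : (n i : ℝ) ≠ 0 := by have := hn i; positivity
  rw [Outcomes.setEffect]
  field_simp

/-- Each control outcome occurs in the `n i - 1` differences of the other members of its set, which
cancels the divisor. -/
theorem sum_diffIf (i : Fin B) : ∑ j, r.diffIf i j = n i * r.setEffect i := by
  rw [← sum_effect hn]
  have h1 : (n i : ℝ) - 1 ≠ 0 := by
    have : (2 : ℝ) ≤ n i := by exact_mod_cast hn i
    linarith
  simp_rw [Outcomes.diffIf, Outcomes.effect, Finset.sum_sub_distrib, ← Finset.sum_div,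
    Finset.sum_erase_eq_sub (Finset.mem_univ _), Finset.sum_sub_distrib]
  simp only [Finset.sum_const, Finset.card_univ, Fintype.card_fin, nsmul_eq_mul]
  field_simp

theorem sum_diffIf_sub_setEffect (i : Fin B) : ∑ j, (r.diffIf i j - r.setEffect i) = 0 := by
  rw [Finset.sum_sub_distrib, sum_diffIf hn]
  simp

theorem Outcomes.WeakNull.sum_eq_zero {τ₀ : ℝ} (h : r.WeakNull τ₀) (hB : 0 < B) :
    ∑ i, (n i : ℝ) * (r.setEffect i - τ₀) = 0 := by
  have hN : total n ≠ 0 := by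
    have := two_mul_le_total hn
    have : (0 : ℝ) < B := by exact_mod_cast hB
    linarith
  have h1 : ∑ i, ∑ j, r.effect i j = τ₀ * total n := by
    rw [← h, Outcomes.avgEffect]
    field_simp
  simp_rw [sum_effect hn] at h1
  simp_rw [mul_sub, Finset.sum_sub_distrib, h1, ← Finset.sum_mul]
  rw [total]
  ring

omit hn in
theorem sampleCov_eq_of_sum_eq_zero (x : Fin B → ℝ) {y : Fin B → ℝ} (hy : ∑ i, y i = 0) :
    sampleCov x y = (∑ i, x i * y i) / ((B : ℝ) - 1) := by
  rw [sampleCov]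
  simp_rw [hy, zero_div, sub_zero, sub_mul, Finset.sum_sub_distrib, ← Finset.mul_sum]
  rw [hy, mul_zero, sub_zero]

/-- The finite-sample bound on the bias of the statistic. -/
theorem HasIndepLaw.condMean_Dbar_le (h : HasIndepLaw w p) {Γ τ₀ : ℝ} (hΓ : 1 ≤ Γ)
    (hp : ∀ i j k, p i j ≤ Γ * p i k) (hr : r.WeakNull τ₀) (hB : 2 ≤ B) :
    condMean w (r.Dbar Γ τ₀)
      ≤ -(2 * ((Γ - 1) / (1 + Γ)) * (((B : ℝ) - 1) / total n) * biasCov r τ₀ w) := by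
  have hN : 0 < total n := by
    have := two_mul_le_total hn
    have : (2 : ℝ) ≤ B := by exact_mod_cast hB
    linarith
  have hB1 : (B : ℝ) - 1 ≠ 0 := by
    have : (2 : ℝ) ≤ B := by exact_mod_cast hB
    linarith
  have hsum := hr.sum_eq_zero hn (by omega)
  rw [h.condMean_Dbar]
  set κ := (Γ - 1) / (1 + Γ) with hκ
  -- Write `diffIf - τ₀` as the deviation from the set average, which sums to zero over the set,
  -- plus the shift `setEffect - τ₀`.
  have hi (i) : wmean (p i) (fun j => tilt Γ (r.diffIf i j - τ₀))
      ≤ (r.setEffect i - τ₀) * (1 + κ)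
        - 2 * κ * (r.setEffect i - τ₀) * MatchedStudy.exceedProb r w i := by
    have h1 := wmean_tilt_nonpos hΓ (hp i) (sum_diffIf_sub_setEffect (r := r) hn i)
    have h2 := (h.law i).wmean_mono fun j =>
      tilt_add_le hΓ (r.diffIf i j - r.setEffect i) (r.setEffect i - τ₀)
    simp only [sub_add_sub_cancel] at h2
    rw [wmean_add, wmean_sub, (h.law i).wmean_const, wmean_const_mul] at h2
    rw [h.exceedProb]
    simp only [sub_nonneg] at h2
    linarith
  calc _ ≤ ∑ i, (n i : ℝ) / total n * ((r.setEffect i - τ₀) * (1 + κ)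
        - 2 * κ * (r.setEffect i - τ₀) * MatchedStudy.exceedProb r w i) := by
        refine Finset.sum_le_sum fun i _ => mul_le_mul_of_nonneg_left (hi i) (by positivity)
    _ = (1 + κ) / total n * ∑ i, (n i : ℝ) * (r.setEffect i - τ₀)
        - 2 * κ / total n * ∑ i, MatchedStudy.exceedProb r w i
          * ((n i : ℝ) * (r.setEffect i - τ₀)) := by
        rw [Finset.mul_sum, Finset.mul_sum, ← Finset.sum_sub_distrib]
        exact Finset.sum_congr rfl fun i _ => by ring
    _ = _ := by
        rw [biasCov, sampleCov_eq_of_sum_eq_zero _ hsum, hsum]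
        field_simp
        ring

end FiniteSample

/-! ### The standard error as a residual norm -/

section StandardErrorFormula

variable {B k : ℕ} {n : Fin B → ℕ} {Q : Matrix (Fin B) (Fin k) ℝ}

theorem residualNorm_mul (Q : Matrix (Fin B) (Fin k) ℝ) {s : ℝ} (hs : 0 ≤ s) (g : Fin B → ℝ) :
    residualNorm Q (fun i => s * g i) = s * residualNorm Q g := by
  have e : (fun i => s * g i / √(1 - hat Q i i)) = s • fun i => g i / √(1 - hat Q i i) := by
    ext i
    simp [mul_div_assoc]
  unfold residualNorm
  simp_rw [e, Matrix.mulVec_smul, Pi.smul_apply, smul_eq_mul, mul_pow, ← Finset.mul_sum]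
  rw [Real.sqrt_mul (sq_nonneg s), Real.sqrt_sq hs]

/-- The quadratic form of a projection is a squared norm, and the factor `B` in `Y` cancels the
division by `B ^ 2`. -/
theorem Outcomes.se_assign (r : Outcomes n) (hB : 0 < B) (hQ : IsUnit (Q.transpose * Q))
    (Γ τ₀ : ℝ) (t : ∀ i, Fin (n i)) :
    r.se Q Γ τ₀ (assign t)
      = residualNorm Q (fun i => (n i : ℝ) / total n * tilt Γ (r.diffIf i (t i) - τ₀)) := by
  have hB' : (0 : ℝ) < B := by exact_mod_cast hB
  have e : r.Y Q Γ τ₀ (assign t) = fun i => (B : ℝ) *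
      ((n i : ℝ) / total n * tilt Γ (r.diffIf i (t i) - τ₀)) / √(1 - hat Q i i) := by
    ext i
    rw [Y, D_assign, mul_assoc]
  have h := residualNorm_mul Q hB'.le
    (fun i => (n i : ℝ) / total n * tilt Γ (r.diffIf i (t i) - τ₀))
  rw [se, dotProduct_mulVec_of_projection (one_sub_hat_transpose Q) (one_sub_hat_mul_self hQ), e,
    Real.sqrt_div' _ (sq_nonneg _), Real.sqrt_sq hB'.le, ← residualNorm, h]
  field_simp

end StandardErrorFormula

/-- Lyapunov's condition implies Lindeberg's: on the tail `|X| ^ η` exceeds `δ ^ η`. -/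
theorem IsLaw.tailSq_le {Ω : Type*} [Fintype Ω] {w : Ω → ℝ} (hw : IsLaw w) (X : Ω → ℝ) {δ η : ℝ}
    (hδ : 0 < δ) (hη : 0 < η) :
    tailSq w X δ ≤ (δ ^ η)⁻¹ * wmean w fun x => |X x| ^ (2 + η) := by
  rw [← wmean_const_mul]
  refine hw.wmean_mono fun x => ?_
  have hδη : 0 < δ ^ η := Real.rpow_pos_of_pos hδ η
  split_ifs with h
  · rw [Real.rpow_add (hδ.trans h), ← div_eq_inv_mul, le_div_iff₀ hδη, ← sq_abs]
    norm_cast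
    exact mul_le_mul_of_nonneg_left (Real.rpow_le_rpow hδ.le h.le hη.le) (sq_nonneg _)
  · positivity

/-! ### From the test to a standardized Lindeberg array -/

namespace Design

variable {k : ℕ} (d : Design k) (r : d.OutcomeArray) (Γ τ₀ : ℝ)

/-- The contribution of set `i` to the statistic, as a function of its treated individual. -/
def contrib : d.UnitArray := fun B i j =>
  (d.n B i : ℝ) / total (d.n B) * tilt Γ ((r B).diffIf i j - τ₀)

/-- The variance of the statistic when the treated individuals are independent with laws `q`. -/
def indepVar (q : d.UnitArray) (B : ℕ) : ℝ :=
  ∑ i, wmean (q B i) fun j =>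
    (d.contrib r Γ τ₀ B i j - wmean (q B i) (d.contrib r Γ τ₀ B i)) ^ 2

/-- The expected contribution of set `i`, standardized. -/
def stdMean (q : d.UnitArray) (B : ℕ) (i : Fin B) : ℝ :=
  (√(d.indepVar r Γ τ₀ q B))⁻¹ * wmean (q B i) (d.contrib r Γ τ₀ B i)

/-- The contribution of set `i`, centred and standardized. -/
def stdContrib (q : d.UnitArray) : d.UnitArray := fun B i j =>
  (√(d.indepVar r Γ τ₀ q B))⁻¹
    * (d.contrib r Γ τ₀ B i j - wmean (q B i) (d.contrib r Γ τ₀ B i))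

variable {d r Γ τ₀} {prob q : d.UnitArray} (hq : ∀ B, HasIndepLaw (assignWeight (prob B)) (q B))

theorem stdContrib_add_stdMean (B : ℕ) (i : Fin B) (j : Fin (d.n B i)) :
    d.stdContrib r Γ τ₀ q B i j + d.stdMean r Γ τ₀ q B i
      = (√(d.indepVar r Γ τ₀ q B))⁻¹ * d.contrib r Γ τ₀ B i j := by
  rw [stdContrib, stdMean]
  ring

include hq

theorem condVar_eq_indepVar (B : ℕ) :
    condVar (assignWeight (prob B)) ((r B).Dbar Γ τ₀) = d.indepVar r Γ τ₀ q B := by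
  rw [(hq B).condVar_Dbar, indepVar]
  simp_rw [← wmean_const_mul]
  rfl

theorem sum_stdMean (B : ℕ) :
    ∑ i, d.stdMean r Γ τ₀ q B i = condMean (assignWeight (prob B)) ((r B).Dbar Γ τ₀)
      / √(condVar (assignWeight (prob B)) ((r B).Dbar Γ τ₀)) := by
  rw [condVar_eq_indepVar hq, (hq B).condMean_Dbar, div_eq_inv_mul, Finset.mul_sum]
  simp_rw [stdMean, ← wmean_const_mul]
  rfl

theorem Regular.eventually_pos (hreg : d.Regular r prob Γ τ₀) :
    ∀ᶠ B in atTop, 0 < d.indepVar r Γ τ₀ q B := by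
  obtain ⟨⟨c, hc, h⟩, -⟩ := hreg
  filter_upwards [h] with B hB
  rw [condVar_eq_indepVar hq] at hB
  by_contra hn
  exact absurd (mul_nonpos_of_nonneg_of_nonpos (Nat.cast_nonneg B) (not_lt.1 hn))
    (not_le.2 (hc.trans_le hB))

theorem sum_wmean_stdContrib_rpow (B : ℕ) (η : ℝ) :
    ∑ i, wmean (q B i) (fun j => |d.stdContrib r Γ τ₀ q B i j| ^ (2 + η))
      = lyapunovRatio (r B) Γ τ₀ (assignWeight (prob B)) η := by
  have hV : 0 ≤ d.indepVar r Γ τ₀ q B :=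
    Finset.sum_nonneg fun i _ => ((hq B).law i).wmean_nonneg fun j => sq_nonneg _
  rw [lyapunovRatio, condVar_eq_indepVar hq, div_eq_inv_mul, Finset.mul_sum]
  refine Finset.sum_congr rfl fun i _ => ?_
  have hn : 0 ≤ (d.n B i : ℝ) / total (d.n B) :=
    div_nonneg (Nat.cast_nonneg _) (Finset.sum_nonneg fun i _ => Nat.cast_nonneg _)
  have e : (condMean (assignWeight (prob B)) fun z => |(r B).D Γ τ₀ z i
      - condMean (assignWeight (prob B)) fun z' => (r B).D Γ τ₀ z' i| ^ (2 + η))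
      = wmean (q B i) fun j => |tilt Γ ((r B).diffIf i j - τ₀)
        - wmean (q B i) fun j => tilt Γ ((r B).diffIf i j - τ₀)| ^ (2 + η) :=
    (hq B).condMean_apply fun t => by rw [(r B).D_assign, (hq B).condMean_D]
  rw [e, ← wmean_const_mul, ← wmean_const_mul]
  congr 1
  ext j
  have e2 : d.stdContrib r Γ τ₀ q B i j = (√(d.indepVar r Γ τ₀ q B))⁻¹ *
      ((d.n B i : ℝ) / total (d.n B) * (tilt Γ ((r B).diffIf i j - τ₀)
        - wmean (q B i) fun j => tilt Γ ((r B).diffIf i j - τ₀))) := by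
    rw [stdContrib, mul_sub ((d.n B i : ℝ) / total (d.n B)), ← wmean_const_mul]
    rfl
  rw [e2, abs_mul, abs_mul, abs_of_nonneg hn, abs_of_nonneg (inv_nonneg.2 (Real.sqrt_nonneg _)),
    Real.mul_rpow (by positivity) (by positivity), Real.mul_rpow hn (by positivity),
    Real.inv_rpow (Real.sqrt_nonneg _), Real.sqrt_eq_rpow, ← Real.rpow_mul hV]
  congr 3
  ring

theorem isLindebergArray_stdContrib (hreg : d.Regular r prob Γ τ₀) :
    IsLindebergArray q (d.stdContrib r Γ τ₀ q) where
  law B := (hq B).law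
  centred B i := by
    unfold stdContrib
    rw [wmean_const_mul, wmean_sub, ((hq B).law i).wmean_const, sub_self, mul_zero]
  variance := by
    filter_upwards [hreg.eventually_pos hq] with B hB
    simp_rw [stdContrib, mul_pow, wmean_const_mul, ← Finset.mul_sum]
    rw [← indepVar, inv_pow, Real.sq_sqrt hB.le, inv_mul_cancel₀ hB.ne']
  lindeberg δ hδ := by
    obtain ⟨-, η, hη, h⟩ := hreg
    have h2 := h.const_mul ((δ ^ η)⁻¹)
    rw [mul_zero] at h2
    refine squeeze_zero (fun B => Finset.sum_nonneg fun i _ => ((hq B).law i).tailSq_nonneg _ _)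
      (fun B => ?_) h2
    rw [← sum_wmean_stdContrib_rpow hq, Finset.mul_sum]
    exact Finset.sum_le_sum fun i _ => ((hq B).law i).tailSq_le _ hδ hη

/-- The test ratio is scale invariant, so dividing every contribution by the standard deviation
changes nothing once that is positive and the hat matrix is a projection. -/
theorem eventually_size_eq (hreg : d.Regular r prob Γ τ₀) (α : ℝ) :
    ∀ᶠ B in atTop, rejectProb q (d.stdContrib r Γ τ₀ q) d.Q (d.stdMean r Γ τ₀ q)
      (normalQuantile (1 - α)) B = d.size r prob Γ τ₀ α B := by
  filter_upwards [hreg.eventually_pos hq, eventually_gt_atTop k] with B hB hk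
  have hs : 0 < (√(d.indepVar r Γ τ₀ q B))⁻¹ := inv_pos.2 (Real.sqrt_pos.2 hB)
  rw [size, (hq B).condMean_eq, rejectProb, ← wmean_ite_eq_wprob]
  congr 1
  ext t
  unfold Outcomes.test
  simp_rw [stdContrib_add_stdMean, ← Finset.mul_sum]
  rw [residualNorm_mul _ hs.le (fun i => d.contrib r Γ τ₀ B i (t i)), mul_div_mul_left _ _ hs.ne',
    (r B).se_assign (by omega) (d.isUnit_gram B hk), (r B).Dbar_assign]
  rfl

theorem size_nonneg (α : ℝ) (B : ℕ) : 0 ≤ d.size r prob Γ τ₀ α B := by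
  rw [size, (hq B).condMean_eq]
  refine (IsLaw.prodWeight (hq B).law).wmean_nonneg fun t => ?_
  unfold Outcomes.test
  split_ifs <;> norm_num

theorem limsup_size_le {α : ℝ} (hα₀ : 0 < α) (hα : α ≤ 1 / 2) (hreg : d.Regular r prob Γ τ₀)
    (hm : ∀ ε > 0, ∀ᶠ B in atTop, condMean (assignWeight (prob B)) ((r B).Dbar Γ τ₀)
      / √(condVar (assignWeight (prob B)) ((r B).Dbar Γ τ₀)) ≤ ε) :
    limsup (d.size r prob Γ τ₀ α) atTop ≤ α := by
  refine le_of_forall_gt_imp_ge_of_dense fun b hb => ?_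
  have h := (isLindebergArray_stdContrib hq hreg).eventually_rejectProb_lt (m := d.stdMean r Γ τ₀ q)
    d.isUnit_gram d.leverage_lt (normalQuantile_nonneg (q := 1 - α) (by linarith))
    (fun ε hε => by simpa only [sum_stdMean hq] using hm ε hε) (b := b)
    (by rw [cdf_normalQuantile (by linarith) (by linarith)]; linarith)
  refine limsup_le_of_le ?_ ?_
  -- A real `limsup` needs this side condition; rejection probabilities are bounded below by zero.
  · exact IsBoundedUnder.isCoboundedUnder_le
      (isBoundedUnder_of ⟨0, fun B => size_nonneg hq α B⟩)
  · filter_upwards [h, eventually_size_eq hq hreg α] with B h1 h2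
    rw [← h2]
    exact h1.le

theorem tendsto_size {α : ℝ} (hα₀ : 0 < α) (hα : α ≤ 1 / 2) (hreg : d.Regular r prob Γ τ₀)
    (hm : ∀ B i, wmean (q B i) (fun j => tilt Γ ((r B).diffIf i j - τ₀)) = 0) :
    Tendsto (d.size r prob Γ τ₀ α) atTop (𝓝 α) := by
  have h := (isLindebergArray_stdContrib hq hreg).tendsto_rejectProb (m := d.stdMean r Γ τ₀ q)
    d.isUnit_gram d.leverage_lt (normalQuantile_nonneg (q := 1 - α) (by linarith)) fun B => by
      ext i
      unfold stdMean contrib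
      rw [wmean_const_mul, hm, mul_zero, mul_zero, Pi.zero_apply]
  rw [cdf_normalQuantile (by linarith) (by linarith), sub_sub_cancel] at h
  exact h.congr' (eventually_size_eq hq hreg α)

end Design

/-! ### Studies in which every set average equals the null value -/

section SetNull

variable {B : ℕ} {n : Fin B → ℕ} {r : Outcomes n} {Γ τ₀ : ℝ}

/-- The average effect of every matched set equals `τ₀`. -/
def Outcomes.SetNull (r : Outcomes n) (τ₀ : ℝ) : Prop := ∀ i, r.setEffect i = τ₀

theorem Outcomes.SetNull.biasCov_eq_zero (h : r.SetNull τ₀) (w : Treatment n → ℝ) :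
    biasCov r τ₀ w = 0 := by
  have e : (fun i => (n i : ℝ) * (r.setEffect i - τ₀)) = fun _ => 0 := by
    ext i
    rw [h i, sub_self, mul_zero]
  rw [biasCov, e]
  simp [sampleCov]

theorem extremeBias_mem_unitCube (r : Outcomes n) (τ₀ : ℝ) : extremeBias r τ₀ ∈ unitCube n := by
  intro i j
  unfold extremeBias
  split_ifs <;> norm_num

theorem SensModel.exists_hasIndepLaw (hn : ∀ i, 2 ≤ n i) (hΓ : 1 ≤ Γ)
    {prob : ∀ i, Fin (n i) → ℝ} (h : SensModel Γ prob) :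
    ∃ u ∈ unitCube n, HasIndepLaw (assignWeight prob) (biasLaw Γ u) ∧
      (∀ i j k, biasLaw Γ u i j ≤ Γ * biasLaw Γ u i k) ∧
      ∀ f, condMean (assignWeight prob) f = condMean (biasWeight Γ u) f := by
  obtain ⟨u, hu, huw⟩ := h.exists_bias hn
  refine ⟨u, hu, ⟨isLaw_biasLaw hn Γ u, fun f => ?_⟩, fun i => biasLaw_le_mul hn hΓ hu i,
    condMean_congr huw⟩
  rw [condMean_congr huw, (hasIndepLaw_biasWeight hn Γ u).condMean_eq]

variable (hn : ∀ i, 2 ≤ n i)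
include hn

theorem Outcomes.SharpNull.setNull (h : r.SharpNull τ₀) : r.SetNull τ₀ := by
  intro i
  have : (n i : ℝ) ≠ 0 := by have := hn i; positivity
  have e (j) : r.effect i j = τ₀ := by rw [Outcomes.effect, h i j]; ring
  simp only [Outcomes.setEffect, e, Finset.sum_const, Finset.card_univ, Fintype.card_fin,
    nsmul_eq_mul]
  field_simp

theorem Outcomes.SetNull.weakNull (h : r.SetNull τ₀) (hB : 0 < B) : r.WeakNull τ₀ := by
  have hN : total n ≠ 0 := by
    have := two_mul_le_total hn
    have : (0 : ℝ) < B := by exact_mod_cast hB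
    linarith
  unfold Outcomes.WeakNull Outcomes.avgEffect
  simp_rw [sum_effect hn, h _, ← Finset.sum_mul]
  rw [← total]
  field_simp

theorem Outcomes.SetNull.sum_diffIf_sub (h : r.SetNull τ₀) (i : Fin B) :
    ∑ j, (r.diffIf i j - τ₀) = 0 := by
  rw [← h i]
  exact sum_diffIf_sub_setEffect hn i

theorem Outcomes.SetNull.wmean_tilt_extremeBias (h : r.SetNull τ₀) (hΓ : 1 ≤ Γ) (i : Fin B) :
    wmean (biasLaw Γ (extremeBias r τ₀) i) (fun j => tilt Γ (r.diffIf i j - τ₀)) = 0 := by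
  refine wmean_tilt_eq_zero hΓ
    (c := (∑ k, Real.exp (Real.log Γ * extremeBias r τ₀ i k))⁻¹) (fun j => ?_)
    (h.sum_diffIf_sub hn i)
  rw [biasLaw, div_eq_inv_mul]
  congr 1
  simp only [extremeBias, sub_nonneg]
  split_ifs
  · rw [mul_one, Real.exp_log (by linarith)]
  · simp

/-- Zero bounds the mean of every set over the whole cube, and `extremeBias` attains it in all sets
at once. This is the explicit maximizer that (b) asks for. -/
theorem Outcomes.SetNull.worstCase_extremeBias (h : r.SetNull τ₀) (hΓ : 1 ≤ Γ) :
    WorstCase r Γ τ₀ (extremeBias r τ₀) := by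
  refine ⟨extremeBias_mem_unitCube r τ₀, fun v hv => ?_⟩
  rw [(hasIndepLaw_biasWeight hn Γ v).condMean_Dbar,
    (hasIndepLaw_biasWeight hn Γ (extremeBias r τ₀)).condMean_Dbar]
  refine Finset.sum_le_sum fun i _ => mul_le_mul_of_nonneg_left ?_
    (div_nonneg (Nat.cast_nonneg _) (Finset.sum_nonneg fun i _ => Nat.cast_nonneg _))
  rw [h.wmean_tilt_extremeBias hn hΓ]
  exact wmean_tilt_nonpos hΓ (biasLaw_le_mul hn hΓ hv i) (h.sum_diffIf_sub hn i)

end SetNull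

/-! ### Asymptotic validity and attainment of the level -/

namespace Design

variable {k : ℕ} {d : Design k} {r : d.OutcomeArray} {prob : d.UnitArray} {Γ τ₀ α : ℝ}

theorem condA_of_setNull (h : ∀ B, (r B).SetNull τ₀) : d.CondA r prob τ₀ := by
  unfold CondA
  simp [(h _).biasCov_eq_zero]

theorem condB_of_setNull (hΓ : 1 ≤ Γ) (h : ∀ B, (r B).SetNull τ₀) : d.CondB r Γ τ₀ := by
  refine ⟨fun B => extremeBias (r B) τ₀,
    fun B => (h B).worstCase_extremeBias (d.two_le B) hΓ, ?_⟩
  simp [(h _).biasCov_eq_zero]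

theorem tendsto_size_of_assignedByExtremeBias (hΓ : 1 ≤ Γ) (hα₀ : 0 < α) (hα : α ≤ 1 / 2)
    (h : ∀ B, (r B).SetNull τ₀) (ha : d.AssignedByExtremeBias r prob Γ τ₀)
    (hreg : d.Regular r prob Γ τ₀) : Tendsto (d.size r prob Γ τ₀ α) atTop (𝓝 α) := by
  refine tendsto_size (q := fun B => biasLaw Γ (extremeBias (r B) τ₀))
    (fun B => ⟨isLaw_biasLaw (d.two_le B) Γ _, fun f => ?_⟩) hα₀ hα hreg
    fun B i => (h B).wmean_tilt_extremeBias (d.two_le B) hΓ i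
  rw [condMean_congr (ha B), (hasIndepLaw_biasWeight (d.two_le B) Γ _).condMean_eq]

/-- A bias of smaller order than the standard deviation does not affect validity. -/
theorem limsup_size_le_of_biasCov (hΓ : 1 ≤ Γ) (hα₀ : 0 < α) (hα : α ≤ 1 / 2)
    (hprob : ∀ B, SensModel Γ (prob B)) (hreg : d.Regular r prob Γ τ₀) {b : ℕ → ℝ}
    (hb : 0 ≤ liminf (fun B : ℕ => ((√(B : ℝ) * b B : ℝ) : EReal)) atTop)
    (hmean : ∀ B, 2 ≤ B → condMean (assignWeight (prob B)) ((r B).Dbar Γ τ₀)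
      ≤ -(2 * ((Γ - 1) / (1 + Γ)) * (((B : ℝ) - 1) / total (d.n B)) * b B)) :
    limsup (d.size r prob Γ τ₀ α) atTop ≤ α := by
  choose u _ hlaw _ _ using fun B => (hprob B).exists_hasIndepLaw (d.two_le B) hΓ
  refine limsup_size_le hlaw hα₀ hα hreg fun ε hε => ?_
  obtain ⟨⟨c, hc, hvar⟩, -⟩ := hreg
  have hc' : 0 < √c := Real.sqrt_pos.2 hc
  have hκ0 : 0 ≤ (Γ - 1) / (1 + Γ) := div_nonneg (by linarith) (by linarith)
  have hκ1 : (Γ - 1) / (1 + Γ) ≤ 1 := (div_le_one (by linarith)).2 (by linarith)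
  -- The threshold is matched to `√c ≤ √B * √V`, so that `-b B` falls below `ε * √V`.
  have hlt : ((-(ε * √c) : ℝ) : EReal)
      < liminf (fun B : ℕ => ((√(B : ℝ) * b B : ℝ) : EReal)) atTop := by
    refine lt_of_lt_of_le ?_ hb
    exact_mod_cast neg_neg_of_pos (mul_pos hε hc')
  filter_upwards [hvar, eventually_lt_of_lt_liminf hlt, eventually_ge_atTop 2] with B hv hbB hB
  have hB2 : (2 : ℝ) ≤ B := by exact_mod_cast hB
  have hsB : 0 < √(B : ℝ) := Real.sqrt_pos.2 (by linarith)
  have hbB' : -(ε * √c) < √(B : ℝ) * b B := by exact_mod_cast hbB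
  have hN := two_mul_le_total (d.two_le B)
  have hN0 : 0 < total (d.n B) := by linarith
  set V := condVar (assignWeight (prob B)) ((r B).Dbar Γ τ₀)
  have hsV : √c ≤ √(B : ℝ) * √V := by
    rw [← Real.sqrt_mul (by linarith)]
    exact Real.sqrt_le_sqrt hv
  have hV : 0 < √V := by
    by_contra hn
    have : √V = 0 := le_antisymm (not_lt.1 hn) (Real.sqrt_nonneg _)
    rw [this, mul_zero] at hsV
    linarith
  rw [div_le_iff₀ hV]
  refine (hmean B hB).trans ?_
  set a := 2 * ((Γ - 1) / (1 + Γ)) * (((B : ℝ) - 1) / total (d.n B)) with ha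
  -- Sets of size at least two give `total ≥ 2 * B`, so the coefficient of the covariance is at most
  -- one.
  have hq : 2 * (((B : ℝ) - 1) / total (d.n B)) ≤ 1 := by
    rw [← mul_div_assoc, div_le_one hN0]
    linarith
  have hq0 : 0 ≤ ((B : ℝ) - 1) / total (d.n B) := div_nonneg (by linarith) hN0.le
  have ha0 : 0 ≤ a := by positivity
  have ha1 : a ≤ 1 := by
    have := mul_le_mul hκ1 hq (by linarith) zero_le_one
    linarith
  have h1 : -(√(B : ℝ) * b B) ≤ ε * (√(B : ℝ) * √V) :=
    le_trans (by linarith) (mul_le_mul_of_nonneg_left hsV hε.le)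
  have h2 : -b B ≤ ε * √V := by
    refine le_of_mul_le_mul_left ?_ hsB
    linarith
  have h3 : 0 ≤ ε * √V := by positivity
  calc -(a * b B) = a * -b B := by ring
    _ ≤ a * (ε * √V) := mul_le_mul_of_nonneg_left h2 ha0
    _ ≤ ε * √V := mul_le_of_le_one_left h3 ha1

theorem limsup_size_le_of_condA (hΓ : 1 ≤ Γ) (hα₀ : 0 < α) (hα : α ≤ 1 / 2)
    (hprob : ∀ B, SensModel Γ (prob B)) (hr : ∀ B, 0 < B → (r B).WeakNull τ₀)
    (hreg : d.Regular r prob Γ τ₀) (h : d.CondA r prob τ₀) :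
    limsup (d.size r prob Γ τ₀ α) atTop ≤ α := by
  refine limsup_size_le_of_biasCov hΓ hα₀ hα hprob hreg h fun B hB => ?_
  obtain ⟨u, -, hlaw, hu, -⟩ := (hprob B).exists_hasIndepLaw (d.two_le B) hΓ
  exact hlaw.condMean_Dbar_le (d.two_le B) hΓ hu (hr B (by omega)) hB

/-- The true law is itself of the form `biasWeight Γ u` with `u` in the cube. Its mean is thus at
most the worst-case mean, to which the bias bound applies. -/
theorem limsup_size_le_of_condB (hΓ : 1 ≤ Γ) (hα₀ : 0 < α) (hα : α ≤ 1 / 2)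
    (hprob : ∀ B, SensModel Γ (prob B)) (hr : ∀ B, 0 < B → (r B).WeakNull τ₀)
    (hreg : d.Regular r prob Γ τ₀) (h : d.CondB r Γ τ₀) :
    limsup (d.size r prob Γ τ₀ α) atTop ≤ α := by
  obtain ⟨v, hv, hcov⟩ := h
  refine limsup_size_le_of_biasCov hΓ hα₀ hα hprob hreg hcov fun B hB => ?_
  obtain ⟨u, hu, -, -, he⟩ := (hprob B).exists_hasIndepLaw (d.two_le B) hΓ
  rw [he]
  exact ((hv B).2 u hu).trans ((hasIndepLaw_biasWeight (d.two_le B) Γ (v B)).condMean_Dbar_le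
    (d.two_le B) hΓ (biasLaw_le_mul (d.two_le B) hΓ (hv B).1) (hr B (by omega)) hB)

end Design

/-! ### Outcomes and assignment probabilities attaining the level -/

section BalancedExample

variable {B : ℕ} {n : Fin B → ℕ} (hn : ∀ i, 2 ≤ n i)

/-- Values of mean zero in each set, positive on the first half of the individuals and negative on
the others, bounded and bounded away from zero. -/
def balanced (n : Fin B → ℕ) (i : Fin B) (j : Fin (n i)) : ℝ :=
  (if (j : ℕ) < n i / 2 then 1 else 0) - ((n i / 2 : ℕ) : ℝ) / n i

/-- Treatment probabilities with odds `Γ` on the first half of each set, and odds one on the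
others. -/
def balancedProb (Γ : ℝ) (n : Fin B → ℕ) (i : Fin B) (j : Fin (n i)) : ℝ :=
  if (j : ℕ) < n i / 2 then Γ / (1 + Γ) else 1 / 2

/-- The values `balanced` scaled so that all sets contribute equally to the statistic. -/
def scaledBalanced (n : Fin B → ℕ) (i : Fin B) (j : Fin (n i)) : ℝ :=
  total n / n i * balanced n i j

/-- Constant effects `τ₀`, and control outcomes for which the difference in means deviates from
`τ₀` by `scaledBalanced`. -/
def sharpOutcomes (n : Fin B → ℕ) (τ₀ : ℝ) : Outcomes n where
  rT i j := scaledBalanced n i j * (((n i : ℝ) - 1) / n i) + τ₀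
  rC i j := scaledBalanced n i j * (((n i : ℝ) - 1) / n i)

/-- Control outcomes zero, and effects which deviate from `τ₀` by `scaledBalanced`. -/
def weakOutcomes (n : Fin B → ℕ) (τ₀ : ℝ) : Outcomes n where
  rT i j := τ₀ + scaledBalanced n i j
  rC _ _ := 0

theorem balancedProb_mem {Γ : ℝ} (hΓ : 1 ≤ Γ) (n : Fin B → ℕ) (i : Fin B) (j : Fin (n i)) :
    0 < balancedProb Γ n i j ∧ balancedProb Γ n i j < 1 := by
  unfold balancedProb
  split_ifs
  · exact ⟨by positivity, (div_lt_one (by linarith)).2 (by linarith)⟩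
  · norm_num

theorem odds_balancedProb {Γ : ℝ} (hΓ : 1 ≤ Γ) (n : Fin B → ℕ) (i : Fin B) (j : Fin (n i)) :
    balancedProb Γ n i j / (1 - balancedProb Γ n i j) = if (j : ℕ) < n i / 2 then Γ else 1 := by
  have : 1 + Γ ≠ 0 := by linarith
  unfold balancedProb
  split_ifs
  · have e : 1 - Γ / (1 + Γ) = 1 / (1 + Γ) := by field_simp; ring
    rw [e]
    field_simp
  · norm_num

theorem sensModel_balancedProb {Γ : ℝ} (hΓ : 1 ≤ Γ) (n : Fin B → ℕ) :
    SensModel Γ (balancedProb Γ n) := by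
  refine ⟨balancedProb_mem hΓ n, fun i j k => ?_⟩
  have e : balancedProb Γ n i j * (1 - balancedProb Γ n i k)
      / (balancedProb Γ n i k * (1 - balancedProb Γ n i j))
      = (if (j : ℕ) < n i / 2 then Γ else 1) / (if (k : ℕ) < n i / 2 then Γ else 1) := by
    rw [← odds_balancedProb hΓ n i j, ← odds_balancedProb hΓ n i k]
    have h1 : 1 - balancedProb Γ n i j ≠ 0 := by linarith [(balancedProb_mem hΓ n i j).2]
    have h2 : 1 - balancedProb Γ n i k ≠ 0 := by linarith [(balancedProb_mem hΓ n i k).2]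
    have h3 := (balancedProb_mem hΓ n i k).1.ne'
    field_simp
  have h0 : Γ ≠ 0 := by linarith
  have h1 : 1 / Γ ≤ 1 := (div_le_one (by linarith)).2 hΓ
  rw [e]
  split_ifs
  · rw [div_self h0]; exact ⟨h1, hΓ⟩
  · rw [div_one]; exact ⟨h1.trans hΓ, le_rfl⟩
  · exact ⟨le_rfl, h1.trans hΓ⟩
  · rw [div_one]; exact ⟨h1, hΓ⟩

include hn

/-- The rounding in `n i / 2` is worst at `n i = 3`, where the fraction is one third. -/
theorem half_bounds (i : Fin B) :
    1 / 3 ≤ ((n i / 2 : ℕ) : ℝ) / n i ∧ ((n i / 2 : ℕ) : ℝ) / n i ≤ 1 / 2 := by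
  have h2 := hn i
  have hpos : (0 : ℝ) < n i := by positivity
  rw [le_div_iff₀ hpos, div_le_iff₀ hpos]
  have h3 : n i ≤ 3 * (n i / 2) := by omega
  have h4 : 2 * (n i / 2) ≤ n i := by omega
  have h3' : (n i : ℝ) ≤ 3 * ((n i / 2 : ℕ) : ℝ) := by exact_mod_cast h3
  have h4' : 2 * ((n i / 2 : ℕ) : ℝ) ≤ n i := by exact_mod_cast h4
  constructor <;> linarith

theorem balanced_nonneg_iff (i : Fin B) (j : Fin (n i)) :
    0 ≤ balanced n i j ↔ (j : ℕ) < n i / 2 := by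
  obtain ⟨h1, h2⟩ := half_bounds hn i
  unfold balanced
  split_ifs with h
  · simp only [h, iff_true]; linarith
  · simp only [h, iff_false]; linarith

theorem abs_balanced_le (i : Fin B) (j : Fin (n i)) : |balanced n i j| ≤ 1 := by
  obtain ⟨h1, h2⟩ := half_bounds hn i
  unfold balanced
  split_ifs <;> rw [abs_le] <;> constructor <;> linarith

theorem le_abs_balanced (i : Fin B) (j : Fin (n i)) : 1 / 3 ≤ |balanced n i j| := by
  obtain ⟨h1, h2⟩ := half_bounds hn i
  rw [le_abs]
  unfold balanced
  split_ifs
  · left; linarith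
  · right; linarith

theorem sum_balanced (i : Fin B) : ∑ j, balanced n i j = 0 := by
  have hpos : (n i : ℝ) ≠ 0 := by have := hn i; positivity
  have hc : (Finset.univ.filter fun j : Fin (n i) => (j : ℕ) < n i / 2).card = n i / 2 := by
    rw [Fin.card_filter_val_lt]
    omega
  simp only [balanced, Finset.sum_sub_distrib, Finset.sum_boole, hc, Finset.sum_const,
    Finset.card_univ, Fintype.card_fin, nsmul_eq_mul]
  field_simp
  ring

theorem sum_scaledBalanced (i : Fin B) : ∑ j, scaledBalanced n i j = 0 := by
  simp_rw [scaledBalanced, ← Finset.mul_sum]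
  rw [sum_balanced hn, mul_zero]

theorem total_div_pos (i : Fin B) : 0 < total n / n i := by
  have h1 := two_mul_le_total hn
  have hB : (1 : ℝ) ≤ B := by exact_mod_cast (show 1 ≤ B by have := i.2; omega)
  have h2 : (0 : ℝ) < n i := by have := hn i; positivity
  exact div_pos (by linarith) h2

theorem scaledBalanced_nonneg_iff (i : Fin B) (j : Fin (n i)) :
    0 ≤ scaledBalanced n i j ↔ (j : ℕ) < n i / 2 := by
  rw [scaledBalanced, mul_nonneg_iff_of_pos_left (total_div_pos hn i), balanced_nonneg_iff hn]

/-- For controls summing to zero, the mean of the others is `-1 / (n i - 1)` times one's own value.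
The difference is therefore stretched by `n i / (n i - 1)`, which the factor in `sharpOutcomes`
undoes. -/
theorem diffIf_sharpOutcomes (τ₀ : ℝ) (i : Fin B) (j : Fin (n i)) :
    (sharpOutcomes n τ₀).diffIf i j = τ₀ + scaledBalanced n i j := by
  have h2 : (2 : ℝ) ≤ n i := by exact_mod_cast hn i
  have h3 : (n i : ℝ) ≠ 0 := by linarith
  have h4 : (n i : ℝ) - 1 ≠ 0 := by linarith
  simp only [Outcomes.diffIf, sharpOutcomes, Finset.sum_erase_eq_sub (Finset.mem_univ _),
    ← Finset.sum_mul, sum_scaledBalanced hn]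
  field_simp
  ring

omit hn in
theorem diffIf_weakOutcomes (τ₀ : ℝ) (i : Fin B) (j : Fin (n i)) :
    (weakOutcomes n τ₀).diffIf i j = τ₀ + scaledBalanced n i j := by
  simp [Outcomes.diffIf, weakOutcomes]

theorem setNull_weakOutcomes (τ₀ : ℝ) : (weakOutcomes n τ₀).SetNull τ₀ := by
  intro i
  have h3 : (n i : ℝ) ≠ 0 := by have := hn i; positivity
  simp only [Outcomes.setEffect, Outcomes.effect, weakOutcomes, sub_zero, Finset.sum_add_distrib,
    sum_scaledBalanced hn, Finset.sum_const, Finset.card_univ, Fintype.card_fin, nsmul_eq_mul]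
  field_simp
  ring

omit hn in
theorem sharpNull_sharpOutcomes (τ₀ : ℝ) : (sharpOutcomes n τ₀).SharpNull τ₀ := fun _ _ => rfl

theorem not_sharpNull_weakOutcomes (hB : 0 < B) (τ₀ : ℝ) : ¬ (weakOutcomes n τ₀).SharpNull τ₀ := by
  intro h
  let i : Fin B := ⟨0, hB⟩
  let j : Fin (n i) := ⟨0, by have := hn i; omega⟩
  have h1 := h i j
  have h2 : scaledBalanced n i j = 0 := by
    simp only [weakOutcomes] at h1
    linarith
  have h3 := le_abs_balanced hn i j
  rcases mul_eq_zero.1 h2 with h4 | h4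
  · exact (total_div_pos hn i).ne' h4
  · rw [h4, abs_zero] at h3
    norm_num at h3

end BalancedExample

/-! ### Regularity of the balanced examples -/

namespace Design

variable {k : ℕ} {d : Design k} {r : d.OutcomeArray} {Γ τ₀ α : ℝ}

/-- The odds are `Γ` exactly on the first half of each set, which is where the difference in means
is at least `τ₀`. -/
theorem assignedByExtremeBias_balanced (hΓ : 1 ≤ Γ)
    (hr : ∀ B i j, (r B).diffIf i j = τ₀ + scaledBalanced (d.n B) i j) :
    d.AssignedByExtremeBias r (fun B => balancedProb Γ (d.n B)) Γ τ₀ := by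
  intro B z hz
  refine condProb_eq_of_odds (d.two_le B) (c := fun _ => 1) (balancedProb_mem hΓ (d.n B))
    (fun i j => ?_) hz
  rw [odds_balancedProb hΓ, extremeBias, hr, one_mul]
  simp only [le_add_iff_nonneg_right, scaledBalanced_nonneg_iff (d.two_le B)]
  split_ifs
  · rw [mul_one, Real.exp_log (by linarith)]
  · simp

/-- The weight `n i / total` cancels the scaling, so set `i` contributes `tilt Γ (balanced ..)`:
centred, bounded, and bounded away from zero uniformly in the design. The variance is then of order
`B`, and Lyapunov's ratio at most of order `1 / B`. -/
theorem regular_balanced (hΓ : 1 ≤ Γ) (h : ∀ B, (r B).SetNull τ₀)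
    (hr : ∀ B i j, (r B).diffIf i j = τ₀ + scaledBalanced (d.n B) i j) :
    d.Regular r (fun B => balancedProb Γ (d.n B)) Γ τ₀ := by
  have hlaw (B) : HasIndepLaw (assignWeight (balancedProb Γ (d.n B)))
      (biasLaw Γ (extremeBias (r B) τ₀)) :=
    ⟨isLaw_biasLaw (d.two_le B) Γ _, fun f => by
      rw [condMean_congr (assignedByExtremeBias_balanced hΓ hr B),
        (hasIndepLaw_biasWeight (d.two_le B) Γ _).condMean_eq]⟩
  set q : d.UnitArray := fun B => biasLaw Γ (extremeBias (r B) τ₀) with hqdef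
  have hw (B i) : (d.n B i : ℝ) / total (d.n B) * (total (d.n B) / d.n B i) = 1 := by
    have h1 := total_div_pos (d.two_le B) i
    rw [← inv_div, inv_mul_cancel₀ h1.ne']
  have hcontrib (B i j) : d.contrib r Γ τ₀ B i j = tilt Γ (balanced (d.n B) i j) := by
    rw [contrib, hr, add_sub_cancel_left, scaledBalanced,
      tilt_mul Γ (total_div_pos (d.two_le B) i).le, ← mul_assoc, hw, one_mul]
  have hmean (B i) : wmean (q B i) (d.contrib r Γ τ₀ B i) = 0 := by
    unfold contrib
    rw [wmean_const_mul, (h B).wmean_tilt_extremeBias (d.two_le B) hΓ, mul_zero]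
  -- The smaller slope of `tilt` times the least absolute value of `balanced`.
  set g := 2 / (1 + Γ) * (1 / 3) with hg
  have hg0 : 0 < g := by positivity
  have hV (B : ℕ) : B * g ^ 2 ≤ d.indepVar r Γ τ₀ q B := by
    have : ∑ _i : Fin B, g ^ 2 ≤ d.indepVar r Γ τ₀ q B := by
      refine Finset.sum_le_sum fun i _ => ?_
      rw [← ((hlaw B).law i).wmean_const (g ^ 2)]
      refine ((hlaw B).law i).wmean_mono fun j => ?_
      rw [hmean, sub_zero, hcontrib, ← sq_abs (tilt _ _)]
      refine pow_le_pow_left₀ hg0.le (le_trans ?_ (le_abs_tilt hΓ _)) 2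
      exact mul_le_mul_of_nonneg_left (le_abs_balanced (d.two_le B) i j) (by positivity)
    simpa using this
  -- Lyapunov's exponent is taken as `η = 2`; contributions bounded by 2 then give the fourth moment
  -- bound 16.
  refine ⟨⟨g ^ 2, by positivity, ?_⟩, 2, two_pos, ?_⟩
  · filter_upwards [eventually_ge_atTop 1] with B hB
    have hB1 : (1 : ℝ) ≤ B := by exact_mod_cast hB
    rw [condVar_eq_indepVar (q := q) hlaw]
    have hB2 : g ^ 2 ≤ d.indepVar r Γ τ₀ q B :=
      (le_mul_of_one_le_left (sq_nonneg g) hB1).trans (hV B)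
    exact hB2.trans (le_mul_of_one_le_left ((sq_nonneg g).trans hB2) hB1)
  · have hlim : Tendsto (fun B : ℕ => 16 / g ^ 4 * (1 / (B : ℝ))) atTop (𝓝 0) := by
      simpa using (tendsto_one_div_atTop_nhds_zero_nat (𝕜 := ℝ)).const_mul (16 / g ^ 4)
    refine squeeze_zero' (Eventually.of_forall fun B => ?_) ?_ hlim
    · rw [← sum_wmean_stdContrib_rpow hlaw]
      exact Finset.sum_nonneg fun i _ => ((hlaw B).law i).wmean_nonneg fun j => by positivity
    · filter_upwards [eventually_ge_atTop 1] with B hB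
      have hB0 : (0 : ℝ) < B := by exact_mod_cast hB
      have hVpos : 0 < d.indepVar r Γ τ₀ q B := lt_of_lt_of_le (by positivity) (hV B)
      rw [← sum_wmean_stdContrib_rpow hlaw]
      have hterm (i) : wmean (q B i) (fun j => |d.stdContrib r Γ τ₀ q B i j| ^ ((2 : ℝ) + 2))
          ≤ 16 / d.indepVar r Γ τ₀ q B ^ 2 := by
        rw [← ((hlaw B).law i).wmean_const (16 / d.indepVar r Γ τ₀ q B ^ 2)]
        refine ((hlaw B).law i).wmean_mono fun j => ?_
        have e4 : ((2 : ℝ) + 2) = ((4 : ℕ) : ℝ) := by norm_num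
        have hs : √(d.indepVar r Γ τ₀ q B) ^ 4 = d.indepVar r Γ τ₀ q B ^ 2 := by
          rw [show 4 = 2 * 2 from rfl, pow_mul, Real.sq_sqrt hVpos.le]
        have ht : |tilt Γ (balanced (d.n B) i j)| ≤ 2 :=
          (abs_tilt_le hΓ _).trans (by linarith [abs_balanced_le (d.two_le B) i j])
        rw [e4, Real.rpow_natCast, stdContrib, hmean, sub_zero, hcontrib, abs_mul, mul_pow, abs_inv,
          abs_of_nonneg (Real.sqrt_nonneg _), inv_pow, hs, div_eq_inv_mul]
        refine mul_le_mul_of_nonneg_left ?_ (by positivity)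
        exact (pow_le_pow_left₀ (abs_nonneg _) ht 4).trans_eq (by norm_num)
      calc _ ≤ ∑ _i : Fin B, 16 / d.indepVar r Γ τ₀ q B ^ 2 := Finset.sum_le_sum fun i _ => hterm i
        _ = B * (16 / d.indepVar r Γ τ₀ q B ^ 2) := by simp
        _ ≤ B * (16 / (B * g ^ 2) ^ 2) := by
          gcongr
          exact hV B
        _ = 16 / g ^ 4 * (1 / (B : ℝ)) := by field_simp

end Design

end MatchedStudy

end

/-! ### The theorem -/

open MatchedStudy in
theorem theorem4 {p : ℕ} (d : Design p) (Γ τ₀ α : ℝ) (hΓ : 1 ≤ Γ) (hα₀ : 0 < α)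
    (hα : α ≤ 1 / 2) :
    -- weak null, validity
    (∀ (r : d.OutcomeArray) (prob : d.UnitArray),
      (∀ B, SensModel Γ (prob B)) → (∀ B, 0 < B → (r B).WeakNull τ₀) →
      d.Regular r prob Γ τ₀ → (d.CondA r prob τ₀ ∨ d.CondB r Γ τ₀) →
      limsup (d.size r prob Γ τ₀ α) atTop ≤ α) ∧
    -- weak null, equality is possible, also when the sharp null fails
    (∃ (r : d.OutcomeArray) (prob : d.UnitArray),
      (∀ B, SensModel Γ (prob B)) ∧ (∀ B, 0 < B → (r B).WeakNull τ₀) ∧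
      (∀ B, 0 < B → ¬ (r B).SharpNull τ₀) ∧
      d.Regular r prob Γ τ₀ ∧ d.CondA r prob τ₀ ∧ d.CondB r Γ τ₀ ∧
      Tendsto (d.size r prob Γ τ₀ α) atTop (𝓝 α)) ∧
    -- sharp null: both conditions hold, validity
    (∀ (r : d.OutcomeArray) (prob : d.UnitArray),
      (∀ B, SensModel Γ (prob B)) → (∀ B, (r B).SharpNull τ₀) →
      d.CondA r prob τ₀ ∧ d.CondB r Γ τ₀ ∧
      (d.Regular r prob Γ τ₀ → limsup (d.size r prob Γ τ₀ α) atTop ≤ α)) ∧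
    -- sharp null: the size is attained under an explicit hidden bias
    (∀ (r : d.OutcomeArray) (prob : d.UnitArray),
      (∀ B, SensModel Γ (prob B)) → (∀ B, (r B).SharpNull τ₀) →
      d.AssignedByExtremeBias r prob Γ τ₀ → d.Regular r prob Γ τ₀ →
      Tendsto (d.size r prob Γ τ₀ α) atTop (𝓝 α)) ∧
    -- sharp null: this occurs in the given design, whatever it is
    (∃ (r : d.OutcomeArray) (prob : d.UnitArray),
      (∀ B, SensModel Γ (prob B)) ∧ (∀ B, (r B).SharpNull τ₀) ∧
      d.AssignedByExtremeBias r prob Γ τ₀ ∧ d.Regular r prob Γ τ₀ ∧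
      Tendsto (d.size r prob Γ τ₀ α) atTop (𝓝 α)) := by
  have hsharp (B : ℕ) : (sharpOutcomes (d.n B) τ₀).SetNull τ₀ :=
    (sharpNull_sharpOutcomes τ₀).setNull (d.two_le B)
  have hweak (B : ℕ) : (weakOutcomes (d.n B) τ₀).SetNull τ₀ := setNull_weakOutcomes (d.two_le B) τ₀
  have hds (B : ℕ) (i : Fin B) (j : Fin (d.n B i)) :=
    diffIf_sharpOutcomes (d.two_le B) τ₀ i j
  have hdw (B : ℕ) (i : Fin B) (j : Fin (d.n B i)) := diffIf_weakOutcomes (n := d.n B) τ₀ i j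
  refine ⟨fun r prob hprob hr hreg h => ?_,
    ⟨fun B => weakOutcomes (d.n B) τ₀, fun B => balancedProb Γ (d.n B), ?_⟩,
    fun r prob hprob hr => ?_, fun r prob _ hr ha hreg => ?_,
    ⟨fun B => sharpOutcomes (d.n B) τ₀, fun B => balancedProb Γ (d.n B), ?_⟩⟩
  · rcases h with h | h
    · exact Design.limsup_size_le_of_condA hΓ hα₀ hα hprob hr hreg h
    · exact Design.limsup_size_le_of_condB hΓ hα₀ hα hprob hr hreg h
  · have hreg := Design.regular_balanced hΓ hweak hdw
    exact ⟨fun B => sensModel_balancedProb hΓ (d.n B), fun B => (hweak B).weakNull (d.two_le B),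
      fun B hB => not_sharpNull_weakOutcomes (d.two_le B) hB τ₀, hreg,
      Design.condA_of_setNull hweak, Design.condB_of_setNull hΓ hweak,
      Design.tendsto_size_of_assignedByExtremeBias hΓ hα₀ hα hweak
        (Design.assignedByExtremeBias_balanced hΓ hdw) hreg⟩
  · have h (B : ℕ) : (r B).SetNull τ₀ := (hr B).setNull (d.two_le B)
    exact ⟨Design.condA_of_setNull h, Design.condB_of_setNull hΓ h, fun hreg =>
      Design.limsup_size_le_of_condA hΓ hα₀ hα hprob (fun B => (h B).weakNull (d.two_le B)) hreg
        (Design.condA_of_setNull h)⟩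
  · exact Design.tendsto_size_of_assignedByExtremeBias hΓ hα₀ hα
      (fun B => (hr B).setNull (d.two_le B)) ha hreg
  · have hreg := Design.regular_balanced hΓ hsharp hds
    have ha := Design.assignedByExtremeBias_balanced hΓ hds
    exact ⟨fun B => sensModel_balancedProb hΓ (d.n B), fun B => sharpNull_sharpOutcomes τ₀, ha, hreg,
      Design.tendsto_size_of_assignedByExtremeBias hΓ hα₀ hα hsharp ha hreg⟩
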